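/- Let $n\ge 1$ and let $\omega_n$ be the volume of the unit ball of $\mathbb R^n$. A Young function is a convex, nondecreasing function $A:[0,\infty)\to[0,\infty)$ with $A(0)=0$, $\lim_{t\to0^+}A(t)/t=0$ and $\lim_{t\to\infty}A(t)/t=\infty$ (no $\Delta_2$ condition is assumed on $A$ or on its conjugate). For measurable $u:\mathbb R^n\to\mathbb R$ and $0<s<1$ put $$\Phi_A(u)=\int_{\mathbb R^n}A(|u|)\,dx,\qquad \Phi_{s,A}(u)=\iint_{\mathbb R^n\times\mathbb R^n}A\!\left(\frac{|u(x)-u(y)|}{|x-y|^s}\right)\frac{dx\,dy}{|x-y|^n}.$$ Let $L^A(\mathbb R^n)$ be the Orlicz space of all measurable $u$ with $\Phi_A(u/\lambda)<\infty$ for some $\lambda>0$, with the Luxemburg norm $\|u\|_{L^A}=\inf\{\lambda>0:\Phi_A(u/\lambda)\le1\}$, and let $W^{s,A}(\mathbb R^n)$ be the space of all measurable $u$ with $\Phi_A(u/\lambda)+\Phi_{s,A}(u/\lambda)<\infty$ for some $\lambda>0$, with the norm $\|u\|_{W^{s,A}}=\|u\|_{L^A}+\inf\{\lambda>0:\Phi_{s,A}(u/\lambda)\le1\}$.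 For $\sigma>0$ let $G_\sigma\in L^1(\mathbb R^n)$ be the Bessel kernel, i.e. the integrable function with $\int_{\mathbb R^n}G_\sigma(x)e^{-ix\cdot\xi}\,dx=(1+|\xi|^2)^{-\sigma/2}$ for all $\xi\in\mathbb R^n$, and let $$H^{\sigma,A}(\mathbb R^n)=\{u\in L^A(\mathbb R^n): u=G_\sigma*f \text{ a.e. for some } f\in L^A(\mathbb R^n)\},\qquad \|u\|_{H^{\sigma,A}}=\|f\|_{L^A}.$$ **Theorem.** There are constants $K,c>0$ depending only on $n$ such that, for every Young function $A$ and all $0<s<s'<1$, the following hold. 1. If $u\in H^{s',A}(\mathbb R^n)$, then $u\in W^{s,A}(\mathbb R^n)$ and $$\|u\|_{W^{s,A}(\mathbb R^n)}\le\frac{C}{s'-s}\,\|u\|_{H^{s',A}(\mathbb R^n)},\qquad C=\frac{K}{s(1-s')}.$$ 2. If $u=G_{s'}*f$ a.e. with $f\in L^A(\mathbb R^n)$, then, as an inequality in $[0,\infty]$, $$\int_{\mathbb R^n}A(|u|)\,dx+\int_{\mathbb R^n}\int_{\mathbb R^n}A\!\left(\frac{|u(x+h)-u(x)|}{|h|^s}\right)\frac{dx\,dh}{|h|^n}\le\frac{C_1}{s'-s}\int_{\mathbb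 R^n}A(C_2|f|)\,dx+\int_{\mathbb R^n}A\big(\|G_{s'}\|_{L^1(\mathbb R^n)}|f|\big)\,dx,$$ where $C_1=\dfrac{2n\omega_n}{s}$ and $C_2=2\|G_{s'}\|_{L^1(\mathbb R^n)}+\dfrac{c}{1-s'}$. -/

import Mathlib

open MeasureTheory Set Filter Topology
open scoped ENNReal FourierTransform Convolution

noncomputable section

/-- A Young function `A : [0, ∞) → [0, ∞)`: convex, non-decreasing, `A 0 = 0`, superlinear at `0`
and at `∞`. Only the values on `[0, ∞)` matter; they are nonnegative by `mono` and `map_zero`. -/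
structure IsYoungFunction (A : ℝ → ℝ) : Prop where
  convex : ConvexOn ℝ (Ici 0) A
  mono : MonotoneOn A (Ici 0)
  map_zero : A 0 = 0
  superlinear_zero : Tendsto (fun t => A t / t) (𝓝[>] 0) (𝓝 0)
  superlinear_top : Tendsto (fun t => A t / t) atTop atTop

/-- The modular `Φ_A(u) = ∫ A(|u|) dx`. -/
def orliczModular {n : ℕ} (A : ℝ → ℝ) (u : EuclideanSpace ℝ (Fin n) → ℝ) : ℝ≥0∞ :=
  ∫⁻ x, ENNReal.ofReal (A |u x|)

/-- The Gagliardo modular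
`Φ_{s,A}(u) = ∬ A(|u(x) - u(y)| / |x - y|^s) |x - y|^{-n} dx dy`. -/
def gagliardoModular {n : ℕ} (A : ℝ → ℝ) (s : ℝ) (u : EuclideanSpace ℝ (Fin n) → ℝ) : ℝ≥0∞ :=
  ∫⁻ y, ∫⁻ x, ENNReal.ofReal (A (|u x - u y| / ‖x - y‖ ^ s) / ‖x - y‖ ^ n)

/-- The Orlicz space `L^A(ℝⁿ)`: measurable functions `u` with `Φ_A(u / t) < ∞` for some `t > 0`,
that is, functions of finite Luxemburg norm. -/
def orliczSpace (n : ℕ) (A : ℝ → ℝ) : Set (EuclideanSpace ℝ (Fin n) → ℝ) :=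
  {u | AEStronglyMeasurable u ∧ ∃ t : ℝ, 0 < t ∧ orliczModular A (fun x => u x / t) < ∞}

/-- The Luxemburg norm on `L^A(ℝⁿ)`. -/
def luxemburgNorm {n : ℕ} (A : ℝ → ℝ) (u : EuclideanSpace ℝ (Fin n) → ℝ) : ℝ :=
  sInf {t : ℝ | 0 < t ∧ orliczModular A (fun x => u x / t) ≤ 1}

/-- The fractional Orlicz-Sobolev space `W^{s,A}(ℝⁿ)`: measurable functions `u` with
`Φ_A(u / t) + Φ_{s,A}(u / t) < ∞` for some `t > 0`. -/
def fracOrliczSobolevSpace (n : ℕ) (A : ℝ → ℝ) (s : ℝ) : Set (EuclideanSpace ℝ (Fin n) → ℝ) :=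
  {u | AEStronglyMeasurable u ∧ ∃ t : ℝ, 0 < t ∧
    orliczModular A (fun x => u x / t) + gagliardoModular A s (fun x => u x / t) < ∞}

/-- The Luxemburg seminorm `[u]_{W^{s,A}}` associated with the Gagliardo modular. -/
def gagliardoSeminorm {n : ℕ} (A : ℝ → ℝ) (s : ℝ) (u : EuclideanSpace ℝ (Fin n) → ℝ) : ℝ :=
  sInf {t : ℝ | 0 < t ∧ gagliardoModular A s (fun x => u x / t) ≤ 1}

/-- The norm `‖u‖_{W^{s,A}} = ‖u‖_{L^A} + [u]_{W^{s,A}}`. -/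
def fracOrliczSobolevNorm {n : ℕ} (A : ℝ → ℝ) (s : ℝ) (u : EuclideanSpace ℝ (Fin n) → ℝ) : ℝ :=
  luxemburgNorm A u + gagliardoSeminorm A s u

/-- `g` is an integrable function whose Fourier transform `∫ g(x) e^{-i x·ξ} dx` is
`(1 + |ξ|²)^{-s/2}`. Mathlib's `𝓕` has the kernel `e^{-2πi x·ξ}`, hence the factor `(2π)⁻¹`. -/
def IsBesselKernel {n : ℕ} (s : ℝ) (g : EuclideanSpace ℝ (Fin n) → ℝ) : Prop :=
  Integrable g ∧ ∀ ξ : EuclideanSpace ℝ (Fin n),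
    𝓕 (fun x => (g x : ℂ)) ((2 * Real.pi)⁻¹ • ξ) = (((1 + ‖ξ‖ ^ 2) ^ (-(s / 2)) : ℝ) : ℂ)

theorem exists_isBesselKernel (n : ℕ) {s : ℝ} (hs : 0 < s) :
    ∃ g : EuclideanSpace ℝ (Fin n) → ℝ, IsBesselKernel s g := by
  set p : ℝ → EuclideanSpace ℝ (Fin n) → ℝ := fun t x =>
    (Real.pi / (4 * t)⁻¹) ^ (-((n : ℝ) / 2)) * Real.exp (-(4 * t)⁻¹ * ‖x‖ ^ 2) with hp
  set w : ℝ → ℝ := fun t => t ^ (s / 2 - 1) * Real.exp (-(1 * t)) with hw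
  set k : ℝ × EuclideanSpace ℝ (Fin n) → ℝ := fun z => w z.1 * p z.1 z.2 with hk
  have hs2 : 0 < s / 2 := by positivity
  have hbpos : ∀ t : ℝ, 0 < t → 0 < (4 * t)⁻¹ := fun t ht => by positivity
  have hcancel : ∀ t : ℝ, 0 < t →
      (Real.pi / (4 * t)⁻¹) ^ (-((n : ℝ) / 2)) * (Real.pi / (4 * t)⁻¹) ^ ((n : ℝ) / 2) = 1 := by
    intro t ht
    have h0 : 0 < Real.pi / (4 * t)⁻¹ := div_pos Real.pi_pos (hbpos t ht)
    rw [← Real.rpow_add h0]; simp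
  have hpint : ∀ t : ℝ, 0 < t → Integrable (p t) := by
    intro t ht
    have h := (GaussianFourier.integrable_cexp_neg_mul_sq_norm_add
      (V := EuclideanSpace ℝ (Fin n)) (b := (((4 * t)⁻¹ : ℝ) : ℂ))
      (by simpa using hbpos t ht) 0 0).re
    refine (h.const_mul ((Real.pi / (4 * t)⁻¹) ^ (-((n : ℝ) / 2)))).congr
      (Eventually.of_forall fun x => ?_)
    simp only [hp]
    congr 1
    have : (-(((4 * t)⁻¹ : ℝ) : ℂ) * (‖x‖ : ℂ) ^ 2
        + 0 * ((inner ℝ (0 : EuclideanSpace ℝ (Fin n)) x : ℝ) : ℂ))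
        = ((-(4 * t)⁻¹ * ‖x‖ ^ 2 : ℝ) : ℂ) := by push_cast; ring
    rw [this]
    exact Complex.exp_ofReal_re _
  have hpone : ∀ t : ℝ, 0 < t → ∫ x, p t x = 1 := by
    intro t ht
    simp only [hp]
    rw [integral_const_mul, GaussianFourier.integral_rexp_neg_mul_sq_norm (hbpos t ht)]
    simpa using hcancel t ht
  have hpnn : ∀ t : ℝ, 0 < t → ∀ x, 0 ≤ p t x := by
    intro t ht x
    have h0 : 0 < Real.pi / (4 * t)⁻¹ := div_pos Real.pi_pos (hbpos t ht)
    positivity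
  have hpF : ∀ t : ℝ, 0 < t → ∀ ξ : EuclideanSpace ℝ (Fin n),
      𝓕 (fun x => (p t x : ℂ)) ((2 * Real.pi)⁻¹ • ξ) = ((Real.exp (-(t * ‖ξ‖ ^ 2)) : ℝ) : ℂ) := by
    intro t ht ξ
    have h := fourier_gaussian_innerProductSpace (V := EuclideanSpace ℝ (Fin n))
      (b := (((4 * t)⁻¹ : ℝ) : ℂ)) (by simpa using hbpos t ht) ((2 * Real.pi)⁻¹ • ξ)
    have h0 : 0 < Real.pi / (4 * t)⁻¹ := div_pos Real.pi_pos (hbpos t ht)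
    have e1 : (fun x => (p t x : ℂ)) = fun x : EuclideanSpace ℝ (Fin n) =>
        (((Real.pi / (4 * t)⁻¹) ^ (-((n : ℝ) / 2)) : ℝ) : ℂ) •
          Complex.exp (-(((4 * t)⁻¹ : ℝ) : ℂ) * (‖x‖ : ℂ) ^ 2) := by
      funext x
      simp only [hp, smul_eq_mul]
      push_cast
      rfl
    rw [e1, Real.fourier_eq]
    simp only [smul_comm _ (((Real.pi / (4 * t)⁻¹) ^ (-((n : ℝ) / 2)) : ℝ) : ℂ)]
    rw [integral_smul, ← Real.fourier_eq, h]
    have e2 : ((Real.pi : ℂ) / (((4 * t)⁻¹ : ℝ) : ℂ)) ^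
        ((Module.finrank ℝ (EuclideanSpace ℝ (Fin n)) : ℂ) / 2)
        = (((Real.pi / (4 * t)⁻¹) ^ ((n : ℝ) / 2) : ℝ) : ℂ) := by
      rw [Complex.ofReal_cpow h0.le]
      simp
    rw [e2, smul_eq_mul, ← mul_assoc, ← Complex.ofReal_mul, hcancel t ht, Complex.ofReal_one,
      one_mul, Complex.ofReal_exp]
    congr 1
    rw [norm_smul, Real.norm_of_nonneg (by positivity)]
    have ht' : (t : ℂ) ≠ 0 := by exact_mod_cast ht.ne'
    have hpi : (Real.pi : ℂ) ≠ 0 := by exact_mod_cast Real.pi_ne_zero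
    push_cast
    field_simp
    ring
  have hwnn : ∀ t : ℝ, 0 < t → 0 ≤ w t := fun t ht => by
    simp only [hw]; positivity
  have hwint : IntegrableOn w (Ioi 0) := by
    have := Real.GammaIntegral_convergent hs2
    refine this.congr_fun (fun t _ => ?_) measurableSet_Ioi
    simp only [hw]; rw [mul_comm]; simp
  have hkint : Integrable k ((volume.restrict (Ioi (0 : ℝ))).prod volume) := by
    have hm : Measurable k := by
      simp only [hk, hw, hp]; fun_prop
    rw [integrable_prod_iff hm.aestronglyMeasurable]
    refine ⟨?_, ?_⟩
    · filter_upwards [ae_restrict_mem measurableSet_Ioi] with t ht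
      exact (hpint t ht).const_mul (w t)
    · refine hwint.congr ?_
      filter_upwards [ae_restrict_mem measurableSet_Ioi] with t ht
      have : ∀ x, ‖k (t, x)‖ = w t * p t x := fun x => by
        rw [Real.norm_of_nonneg (mul_nonneg (hwnn t ht) (hpnn t ht x))]
      simp only [this]
      rw [integral_const_mul, hpone t ht, mul_one]
  have hG : 0 < Real.Gamma (s / 2) := Real.Gamma_pos_of_pos hs2
  refine ⟨fun x => (Real.Gamma (s / 2))⁻¹ * ∫ t in Ioi (0 : ℝ), k (t, x),
    hkint.integral_prod_right.const_mul _, fun ξ => ?_⟩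
  have hkC : Integrable (fun z : ℝ × EuclideanSpace ℝ (Fin n) =>
      𝐞 (-inner ℝ z.2 ((2 * Real.pi)⁻¹ • ξ)) • (k z : ℂ))
      ((volume.restrict (Ioi (0 : ℝ))).prod volume) := by
    refine (hkint.ofReal (𝕜 := ℂ)).mono ?_ (Eventually.of_forall fun z => by simp)
    refine AEStronglyMeasurable.smul ?_ (hkint.ofReal (𝕜 := ℂ)).aestronglyMeasurable
    refine Continuous.aestronglyMeasurable ?_
    exact continuous_subtype_val.comp (show Continuous fun z : ℝ × EuclideanSpace ℝ (Fin n) =>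
      𝐞 (-inner ℝ z.2 ((2 * Real.pi)⁻¹ • ξ)) from
        Real.continuous_fourierChar.comp (by fun_prop))
  have step : ∀ x : EuclideanSpace ℝ (Fin n),
      𝐞 (-inner ℝ x ((2 * Real.pi)⁻¹ • ξ)) •
        (((Real.Gamma (s / 2))⁻¹ * ∫ t in Ioi (0 : ℝ), k (t, x) : ℝ) : ℂ)
      = (((Real.Gamma (s / 2))⁻¹ : ℝ) : ℂ) * ∫ t in Ioi (0 : ℝ),
          𝐞 (-inner ℝ x ((2 * Real.pi)⁻¹ • ξ)) • (k (t, x) : ℂ) := by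
    intro x
    simp only [Circle.smul_def, smul_eq_mul]
    rw [integral_const_mul, integral_complex_ofReal, Complex.ofReal_mul]
    ring
  rw [Real.fourier_eq]
  simp only [step]
  rw [integral_const_mul, integral_integral_swap (f := fun (x : EuclideanSpace ℝ (Fin n)) (t : ℝ) =>
    𝐞 (-inner ℝ x ((2 * Real.pi)⁻¹ • ξ)) • (k (t, x) : ℂ)) hkC.swap]
  have inner_eq : ∀ t ∈ Ioi (0 : ℝ),
      ∫ x : EuclideanSpace ℝ (Fin n), 𝐞 (-inner ℝ x ((2 * Real.pi)⁻¹ • ξ)) • (k (t, x) : ℂ)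
      = ((t ^ (s / 2 - 1) * Real.exp (-((1 + ‖ξ‖ ^ 2) * t)) : ℝ) : ℂ) := by
    intro t ht
    have := hpF t ht ξ
    rw [Real.fourier_eq] at this
    simp only [hk, Complex.ofReal_mul]
    simp only [← mul_smul_comm]
    rw [integral_const_mul, this, ← Complex.ofReal_mul, ← Complex.ofReal_mul]
    congr 1
    simp only [hw]
    rw [mul_assoc, ← Real.exp_add]
    congr 2
    ring
  rw [setIntegral_congr_fun measurableSet_Ioi inner_eq, integral_complex_ofReal,
    Real.integral_rpow_mul_exp_neg_mul_Ioi hs2 (by positivity), ← Complex.ofReal_mul]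
  congr 1
  rw [mul_comm, mul_assoc, mul_inv_cancel₀ hG.ne', mul_one, one_div, Real.rpow_neg (by positivity),
    Real.inv_rpow (by positivity)]

open Classical in
/-- The Bessel kernel `G_s`, the inverse Fourier transform of `(1 + |ξ|²)^{-s/2}`, for `s > 0`
(unique up to null sets; junk value `0` for `s ≤ 0`, where `G_s` is not a function). -/
def besselKernel (n : ℕ) (s : ℝ) : EuclideanSpace ℝ (Fin n) → ℝ :=
  if hs : 0 < s then (exists_isBesselKernel n hs).choose else 0

theorem isBesselKernel_besselKernel (n : ℕ) {s : ℝ} (hs : 0 < s) :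
    IsBesselKernel s (besselKernel n s) := by
  rw [besselKernel, dif_pos hs]
  exact (exists_isBesselKernel n hs).choose_spec

/-- The Bessel potential `G_s * f`. -/
def besselPotential {n : ℕ} (s : ℝ) (f : EuclideanSpace ℝ (Fin n) → ℝ) :
    EuclideanSpace ℝ (Fin n) → ℝ :=
  besselKernel n s ⋆[ContinuousLinearMap.mul ℝ ℝ, volume] f

/-- The Bessel-Orlicz potential space `H^{s,A}(ℝⁿ)`, for `s > 0`. -/
def besselOrliczSpace (n : ℕ) (A : ℝ → ℝ) (s : ℝ) : Set (EuclideanSpace ℝ (Fin n) → ℝ) :=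
  {u | u ∈ orliczSpace n A ∧ ∃ f ∈ orliczSpace n A, u =ᵐ[volume] besselPotential s f}

/-- The norm `‖u‖_{H^{s,A}} = ‖f‖_{L^A}` where `u = G_s * f` with `f ∈ L^A(ℝⁿ)`. Such an `f` is
unique up to null sets, so for `u ∈ H^{s,A}` the infimum is over a single number. -/
def besselOrliczNorm {n : ℕ} (A : ℝ → ℝ) (s : ℝ) (u : EuclideanSpace ℝ (Fin n) → ℝ) : ℝ :=
  sInf {r : ℝ | ∃ f ∈ orliczSpace n A, u =ᵐ[volume] besselPotential s f ∧ r = luxemburgNorm A f}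

end

/-! With `Δ_h v(x) = v(x + h) - v(x)`, a Bessel potential `u = G_σ * f` satisfies `Δ_h u = (Δ_h G_σ)
* f`. Everything therefore reduces to the size of `Δ_h G_σ` in `L¹` and to an Orlicz form of Young's
convolution inequality.

Kernel side. `besselKernel` is chosen abstractly, so only its Fourier transform is known.
Injectivity of the Fourier transform identifies it a.e. with `subordinatedKernel`, the average of
heat kernels with weight `t^(σ/2-1) e^(-t) / Γ(σ/2)`. The heat kernel at time `t` has `‖Δ_h‖₁ ≤
min(2, C‖h‖/√t)`. Integrating this over `t`, split at `t = ‖h‖²`, gives `‖Δ_h G_σ‖₁ ≤ M ‖h‖^σ` with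
`M = c/(1-σ)` (`integral_abs_besselKernel_add_sub_le`).

Modular side. Jensen's inequality for the probability density `|k|/‖k‖₁` gives `∫ A(|k * f|) ≤ ∫
A(‖k‖₁ |f|)`, without any `Δ₂` condition. Apply it to `k = ‖h‖^(-s) Δ_h G_σ`: with `N = ‖G_σ‖₁`, its
mass is at most `θ(h)(2N + M)`, where `θ = ‖h‖^(σ-s)` for `‖h‖ < 1` and `θ = ‖h‖^(-s)` otherwise.
Since `θ ≤ 1` and `A 0 = 0`, convexity extracts it: `A(θ t) ≤ θ A(t)`. The remaining integral of
`θ(h) ‖h‖^(-n)` equals `n ω_n (1/(σ-s) + 1/s)`, which produces the factor `1/(σ-s)`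
(`lintegral_lintegral_difference_besselPotential_le`).

The norm inequality follows from the modular one because convexity lets a multiplicative constant in
front of the modular be absorbed by a dilation of its argument. -/

/-! ### Heat kernels and the subordination formula. -/

/-- The Gauss-Weierstrass kernel at time `t`. -/
noncomputable def heatKernel (n : ℕ) (t : ℝ) (x : EuclideanSpace ℝ (Fin n)) : ℝ :=
  (Real.pi / (4 * t)⁻¹) ^ (-((n : ℝ) / 2)) * Real.exp (-(4 * t)⁻¹ * ‖x‖ ^ 2)

/-- The integrand in the subordination formula for the Bessel kernel. -/
noncomputable def besselIntegrand (n : ℕ) (s : ℝ) (z : ℝ × EuclideanSpace ℝ (Fin n)) : ℝ :=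
  z.1 ^ (s / 2 - 1) * Real.exp (-(1 * z.1)) * heatKernel n z.1 z.2

/-- The Bessel kernel written as a superposition of heat kernels. -/
noncomputable def subordinatedKernel (n : ℕ) (s : ℝ) (x : EuclideanSpace ℝ (Fin n)) : ℝ :=
  (Real.Gamma (s / 2))⁻¹ * ∫ t in Ioi (0 : ℝ), besselIntegrand n s (t, x)

theorem heatKernel_normalization {n : ℕ} {t : ℝ} (ht : 0 < t) :
    (Real.pi / (4 * t)⁻¹) ^ (-((n : ℝ) / 2)) * (Real.pi / (4 * t)⁻¹) ^ ((n : ℝ) / 2) = 1 := by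
  have h0 : 0 < Real.pi / (4 * t)⁻¹ := div_pos Real.pi_pos (by positivity)
  rw [← Real.rpow_add h0]; simp

theorem integrable_exp_neg_mul_sq_norm {n : ℕ} {b : ℝ} (hb : 0 < b) :
    Integrable fun x : EuclideanSpace ℝ (Fin n) => Real.exp (-b * ‖x‖ ^ 2) := by
  have h := (GaussianFourier.integrable_cexp_neg_mul_sq_norm_add
    (V := EuclideanSpace ℝ (Fin n)) (b := (b : ℂ)) (by simpa using hb) 0 0).re
  refine h.congr (Eventually.of_forall fun x => ?_)
  have : (-(b : ℂ) * (‖x‖ : ℂ) ^ 2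
      + 0 * ((inner ℝ (0 : EuclideanSpace ℝ (Fin n)) x : ℝ) : ℂ))
      = ((-b * ‖x‖ ^ 2 : ℝ) : ℂ) := by push_cast; ring
  simp only [this]
  exact Complex.exp_ofReal_re _

theorem integrable_heatKernel {n : ℕ} {t : ℝ} (ht : 0 < t) : Integrable (heatKernel n t) :=
  (integrable_exp_neg_mul_sq_norm (b := (4 * t)⁻¹) (by positivity)).const_mul _

theorem heatKernel_nonneg {n : ℕ} {t : ℝ} (ht : 0 < t) (x : EuclideanSpace ℝ (Fin n)) :
    0 ≤ heatKernel n t x := by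
  have h0 : 0 < Real.pi / (4 * t)⁻¹ := div_pos Real.pi_pos (by positivity)
  unfold heatKernel; positivity

theorem integral_heatKernel {n : ℕ} {t : ℝ} (ht : 0 < t) : ∫ x, heatKernel n t x = 1 := by
  simp only [heatKernel]
  rw [integral_const_mul, GaussianFourier.integral_rexp_neg_mul_sq_norm (by positivity)]
  simpa using heatKernel_normalization ht

theorem fourier_heatKernel {n : ℕ} {t : ℝ} (ht : 0 < t) (ξ : EuclideanSpace ℝ (Fin n)) :
    𝓕 (fun x => (heatKernel n t x : ℂ)) ((2 * Real.pi)⁻¹ • ξ)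
      = ((Real.exp (-(t * ‖ξ‖ ^ 2)) : ℝ) : ℂ) := by
  have hb : 0 < (4 * t)⁻¹ := by positivity
  have h := fourier_gaussian_innerProductSpace (V := EuclideanSpace ℝ (Fin n))
    (b := (((4 * t)⁻¹ : ℝ) : ℂ)) (by simpa using hb) ((2 * Real.pi)⁻¹ • ξ)
  have h0 : 0 < Real.pi / (4 * t)⁻¹ := div_pos Real.pi_pos hb
  have e1 : (fun x => (heatKernel n t x : ℂ)) = fun x : EuclideanSpace ℝ (Fin n) =>
      (((Real.pi / (4 * t)⁻¹) ^ (-((n : ℝ) / 2)) : ℝ) : ℂ) •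
        Complex.exp (-(((4 * t)⁻¹ : ℝ) : ℂ) * (‖x‖ : ℂ) ^ 2) := by
    funext x
    simp only [heatKernel, smul_eq_mul]
    push_cast
    rfl
  rw [e1, Real.fourier_eq]
  simp only [smul_comm _ (((Real.pi / (4 * t)⁻¹) ^ (-((n : ℝ) / 2)) : ℝ) : ℂ)]
  rw [integral_smul, ← Real.fourier_eq, h]
  have e2 : ((Real.pi : ℂ) / (((4 * t)⁻¹ : ℝ) : ℂ)) ^
      ((Module.finrank ℝ (EuclideanSpace ℝ (Fin n)) : ℂ) / 2)
      = (((Real.pi / (4 * t)⁻¹) ^ ((n : ℝ) / 2) : ℝ) : ℂ) := by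
    rw [Complex.ofReal_cpow h0.le]
    simp
  rw [e2, smul_eq_mul, ← mul_assoc, ← Complex.ofReal_mul, heatKernel_normalization ht,
    Complex.ofReal_one, one_mul, Complex.ofReal_exp]
  congr 1
  rw [norm_smul, Real.norm_of_nonneg (by positivity)]
  have ht' : (t : ℂ) ≠ 0 := by exact_mod_cast ht.ne'
  have hpi : (Real.pi : ℂ) ≠ 0 := by exact_mod_cast Real.pi_ne_zero
  push_cast
  field_simp
  ring

theorem measurable_besselIntegrand (n : ℕ) (s : ℝ) : Measurable (besselIntegrand n s) := by
  unfold besselIntegrand heatKernel; fun_prop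

theorem integrable_besselIntegrand {n : ℕ} {s : ℝ} (hs : 0 < s) :
    Integrable (besselIntegrand n s) ((volume.restrict (Ioi (0 : ℝ))).prod volume) := by
  have hwint : IntegrableOn (fun t : ℝ => t ^ (s / 2 - 1) * Real.exp (-(1 * t))) (Ioi 0) := by
    refine (Real.GammaIntegral_convergent (half_pos hs)).congr_fun (fun t _ => ?_)
      measurableSet_Ioi
    simp only []; rw [mul_comm]; simp
  rw [integrable_prod_iff (measurable_besselIntegrand n s).aestronglyMeasurable]
  refine ⟨?_, ?_⟩
  · filter_upwards [ae_restrict_mem measurableSet_Ioi] with t ht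
    exact (integrable_heatKernel ht).const_mul (t ^ (s / 2 - 1) * Real.exp (-(1 * t)))
  · refine hwint.congr ?_
    filter_upwards [ae_restrict_mem measurableSet_Ioi] with t ht
    have h1 : ∀ x, ‖besselIntegrand n s (t, x)‖
        = t ^ (s / 2 - 1) * Real.exp (-(1 * t)) * heatKernel n t x := fun x => by
      rw [besselIntegrand, Real.norm_of_nonneg]
      have := heatKernel_nonneg ht x
      have : (0 : ℝ) < t := ht
      positivity
    simp only [h1]
    rw [integral_const_mul, integral_heatKernel ht, mul_one]

/-- By Fubini the Fourier transform may be taken at fixed `t`, where it is `exp(-t|ξ|²)`. What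
remains is the Gamma integral of `t^(s/2-1) exp(-(1+|ξ|²)t)`. -/
theorem isBesselKernel_subordinatedKernel {n : ℕ} {s : ℝ} (hs : 0 < s) :
    IsBesselKernel s (subordinatedKernel n s) := by
  have hs2 : 0 < s / 2 := half_pos hs
  have hG : 0 < Real.Gamma (s / 2) := Real.Gamma_pos_of_pos hs2
  have hkint := integrable_besselIntegrand (n := n) hs
  refine ⟨hkint.integral_prod_right.const_mul _, fun ξ => ?_⟩
  have hkC : Integrable (fun z : ℝ × EuclideanSpace ℝ (Fin n) =>
      𝐞 (-inner ℝ z.2 ((2 * Real.pi)⁻¹ • ξ)) • (besselIntegrand n s z : ℂ))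
      ((volume.restrict (Ioi (0 : ℝ))).prod volume) := by
    refine (hkint.ofReal (𝕜 := ℂ)).mono ?_ (Eventually.of_forall fun z => by simp)
    refine AEStronglyMeasurable.smul ?_ (hkint.ofReal (𝕜 := ℂ)).aestronglyMeasurable
    refine Continuous.aestronglyMeasurable ?_
    exact continuous_subtype_val.comp (show Continuous fun z : ℝ × EuclideanSpace ℝ (Fin n) =>
      𝐞 (-inner ℝ z.2 ((2 * Real.pi)⁻¹ • ξ)) from
        Real.continuous_fourierChar.comp (by fun_prop))
  have step : ∀ x : EuclideanSpace ℝ (Fin n),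
      𝐞 (-inner ℝ x ((2 * Real.pi)⁻¹ • ξ)) • (subordinatedKernel n s x : ℂ)
      = (((Real.Gamma (s / 2))⁻¹ : ℝ) : ℂ) * ∫ t in Ioi (0 : ℝ),
          𝐞 (-inner ℝ x ((2 * Real.pi)⁻¹ • ξ)) • (besselIntegrand n s (t, x) : ℂ) := by
    intro x
    simp only [Circle.smul_def, smul_eq_mul, subordinatedKernel]
    rw [integral_const_mul, integral_complex_ofReal, Complex.ofReal_mul]
    ring
  rw [Real.fourier_eq]
  simp only [step]
  rw [integral_const_mul, integral_integral_swap (f := fun (x : EuclideanSpace ℝ (Fin n)) (t : ℝ) =>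
    𝐞 (-inner ℝ x ((2 * Real.pi)⁻¹ • ξ)) • (besselIntegrand n s (t, x) : ℂ)) hkC.swap]
  have inner_eq : ∀ t ∈ Ioi (0 : ℝ),
      ∫ x : EuclideanSpace ℝ (Fin n),
        𝐞 (-inner ℝ x ((2 * Real.pi)⁻¹ • ξ)) • (besselIntegrand n s (t, x) : ℂ)
      = ((t ^ (s / 2 - 1) * Real.exp (-((1 + ‖ξ‖ ^ 2) * t)) : ℝ) : ℂ) := by
    intro t ht
    have := fourier_heatKernel ht ξ
    rw [Real.fourier_eq] at this
    simp only [besselIntegrand, Complex.ofReal_mul]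
    simp only [← mul_smul_comm]
    rw [integral_const_mul, this]
    simp only [← Complex.ofReal_mul]
    congr 1
    rw [mul_assoc, ← Real.exp_add]
    congr 2
    ring
  rw [setIntegral_congr_fun measurableSet_Ioi inner_eq, integral_complex_ofReal,
    Real.integral_rpow_mul_exp_neg_mul_Ioi hs2 (by positivity), ← Complex.ofReal_mul]
  congr 1
  rw [mul_comm, mul_assoc, mul_inv_cancel₀ hG.ne', mul_one, one_div, Real.rpow_neg (by positivity),
    Real.inv_rpow (by positivity)]

/-! ### Uniqueness of the Bessel kernel. -/

/-- An integrable real function with vanishing Fourier transform vanishes almost everywhere. -/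
theorem ae_eq_zero_of_fourier_eq_zero {n : ℕ} {g : EuclideanSpace ℝ (Fin n) → ℝ}
    (hg : Integrable g) (h : ∀ ξ, 𝓕 (fun x => (g x : ℂ)) ξ = 0) : g =ᵐ[volume] 0 := by
  set μ := volume.withDensity fun x => ENNReal.ofReal (g x) with hμ
  set ν := volume.withDensity fun x => ENNReal.ofReal (-g x) with hν
  have : IsFiniteMeasure μ := isFiniteMeasure_withDensity_ofReal hg.2
  have : IsFiniteMeasure ν := isFiniteMeasure_withDensity_ofReal hg.neg.2
  have hm : AEMeasurable g := hg.aestronglyMeasurable.aemeasurable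
  have hm' : AEMeasurable fun x => -g x := hm.neg
  -- The positive and negative parts of `g` are densities of finite measures, and finite measures
  -- are determined by their characteristic functions.
  have hμν : μ = ν := by
    apply Measure.ext_of_charFun
    funext t
    rw [charFun_apply, charFun_apply, hμ, hν,
      integral_withDensity_eq_integral_toReal_smul₀ hm.ennreal_ofReal (by simp),
      integral_withDensity_eq_integral_toReal_smul₀ hm'.ennreal_ofReal (by simp),
      ← sub_eq_zero, ← integral_sub]
    -- The characteristic function at `t` is the Fourier transform at `-t/(2π)`.
    · rw [← h (-((2 * Real.pi)⁻¹ • t)), Real.fourier_eq']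
      refine integral_congr_ae (Eventually.of_forall fun x => ?_)
      have e : (ENNReal.ofReal (g x)).toReal - (ENNReal.ofReal (-g x)).toReal = g x := by
        rw [ENNReal.toReal_ofReal', ENNReal.toReal_ofReal', max_zero_sub_eq_self]
      simp only []
      rw [← sub_smul, e, inner_neg_right, inner_smul_right, Complex.real_smul, smul_eq_mul,
        mul_comm]
      congr 3
      have hpi : (Real.pi : ℂ) ≠ 0 := by exact_mod_cast Real.pi_ne_zero
      push_cast
      field_simp
    · refine (hg.pos_part.ofReal (𝕜 := ℂ)).mono ?_ (Eventually.of_forall fun x => ?_)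
      · exact (hm.ennreal_ofReal.ennreal_toReal.smul (by fun_prop)).aestronglyMeasurable
      · rw [norm_smul, Complex.norm_exp_ofReal_mul_I, ENNReal.toReal_ofReal']
        simp
    · refine (hg.neg_part.ofReal (𝕜 := ℂ)).mono ?_ (Eventually.of_forall fun x => ?_)
      · exact (hm'.ennreal_ofReal.ennreal_toReal.smul (by fun_prop)).aestronglyMeasurable
      · rw [norm_smul, Complex.norm_exp_ofReal_mul_I, ENNReal.toReal_ofReal']
        simp
  rw [hμ, hν, withDensity_eq_iff_of_sigmaFinite hm.ennreal_ofReal hm'.ennreal_ofReal] at hμν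
  filter_upwards [hμν] with x hx
  have e : (ENNReal.ofReal (g x)).toReal - (ENNReal.ofReal (-g x)).toReal = g x := by
    rw [ENNReal.toReal_ofReal', ENNReal.toReal_ofReal', max_zero_sub_eq_self]
  rw [Pi.zero_apply, ← e, hx, sub_self]

theorem IsBesselKernel.ae_eq {n : ℕ} {s : ℝ} {g g' : EuclideanSpace ℝ (Fin n) → ℝ}
    (hg : IsBesselKernel s g) (hg' : IsBesselKernel s g') : g =ᵐ[volume] g' := by
  have h : (g - g') =ᵐ[volume] 0 := by
    refine ae_eq_zero_of_fourier_eq_zero (hg.1.sub hg'.1) fun ξ => ?_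
    have h1 := hg.2 ((2 * Real.pi) • ξ)
    rw [← hg'.2, smul_smul, inv_mul_cancel₀ (by positivity), one_smul] at h1
    rw [Real.fourier_eq, Real.fourier_eq] at h1
    rw [Real.fourier_eq]
    have i1 := (Real.fourierIntegral_convergent_iff (μ := volume) ξ).2 (hg.1.ofReal (𝕜 := ℂ))
    have i2 := (Real.fourierIntegral_convergent_iff (μ := volume) ξ).2 (hg'.1.ofReal (𝕜 := ℂ))
    simp only [Pi.sub_apply, Complex.ofReal_sub, smul_sub]
    exact (integral_sub i1 i2).trans (sub_eq_zero.2 h1)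
  filter_upwards [h] with x hx
  simpa [sub_eq_zero] using hx

/-! ### The `L¹` modulus of continuity of the heat kernel. -/

theorem abs_exp_neg_sub_exp_neg_le (a b : ℝ) :
    |Real.exp (-a) - Real.exp (-b)| ≤ |a - b| * (Real.exp (-a) + Real.exp (-b)) := by
  wlog hab : a ≤ b generalizing a b
  · rw [abs_sub_comm, abs_sub_comm a b, add_comm]
    exact this b a (le_of_not_ge hab)
  rw [abs_of_nonneg (sub_nonneg.2 (Real.exp_le_exp.2 (by linarith))),
    abs_of_nonpos (sub_nonpos.2 hab)]
  have h1 : Real.exp (-b) = Real.exp (-a) * Real.exp (a - b) := by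
    rw [← Real.exp_add]; ring_nf
  have h2 := Real.add_one_le_exp (a - b)
  have h3 := mul_le_mul_of_nonneg_left h2 (Real.exp_pos (-a)).le
  have h4 : 0 ≤ (b - a) * Real.exp (-b) := mul_nonneg (by linarith) (Real.exp_pos _).le
  rw [h1] at h4 ⊢
  nlinarith

theorem mul_exp_neg_sq_le (y : ℝ) : y * Real.exp (-y ^ 2) ≤ Real.exp (-(y ^ 2 / 2)) := by
  have h1 : Real.exp (-(y ^ 2 / 2)) = Real.exp (-y ^ 2) * Real.exp (y ^ 2 / 2) := by
    rw [← Real.exp_add]; ring_nf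
  have h2 := Real.add_one_le_exp (y ^ 2 / 2)
  rw [h1, mul_comm]
  gcongr
  nlinarith [sq_nonneg (y - 1)]

theorem heatKernel_two_mul {n : ℕ} {t : ℝ} (ht : 0 < t) (x : EuclideanSpace ℝ (Fin n)) :
    (2 : ℝ) ^ ((n : ℝ) / 2) * heatKernel n (2 * t) x
      = (Real.pi / (4 * t)⁻¹) ^ (-((n : ℝ) / 2)) * Real.exp (-((4 * t)⁻¹ * ‖x‖ ^ 2 / 2)) := by
  have h0 : 0 < Real.pi / (4 * t)⁻¹ := div_pos Real.pi_pos (by positivity)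
  have e : Real.pi / (4 * (2 * t))⁻¹ = 2 * (Real.pi / (4 * t)⁻¹) := by field_simp
  rw [heatKernel, e, Real.mul_rpow (by norm_num) h0.le, ← mul_assoc, ← mul_assoc,
    ← Real.rpow_add (by norm_num), add_neg_cancel, Real.rpow_zero, one_mul]
  congr 2
  field_simp

/-- The difference of two Gaussians brings down a factor linear in `‖x‖/√t`. Half of the exponent
absorbs it, and a Gaussian with halved exponent is the heat kernel at time `2t`, up to `2^(n/2)`. -/
theorem abs_heatKernel_add_sub_le {n : ℕ} {t : ℝ} (ht : 0 < t) (x h : EuclideanSpace ℝ (Fin n))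
    (hh : ‖h‖ ≤ 2 * √t) :
    |heatKernel n t (x + h) - heatKernel n t x| ≤ 3 * (‖h‖ / (2 * √t)) *
      ((2 : ℝ) ^ ((n : ℝ) / 2) * (heatKernel n (2 * t) (x + h) + heatKernel n (2 * t) x)) := by
  have hsq : 0 < √t := Real.sqrt_pos.2 ht
  set ρ : ℝ := (2 * √t)⁻¹ with hρ
  have hρ0 : 0 < ρ := by positivity
  have hr : (4 * t)⁻¹ = ρ ^ 2 := by
    rw [hρ, inv_pow, mul_pow, Real.sq_sqrt ht.le]; norm_num
  have hρh : ρ * ‖h‖ ≤ 1 := by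
    rw [hρ, inv_mul_le_iff₀ (by positivity)]; linarith
  -- Here `ρ(a + b) ≤ 2ρa + 1`, because `ρ‖h‖ ≤ 1`; the two terms contribute `2` and `1` to the
  -- constant `3`.
  have key : ∀ a b : ℝ, 0 ≤ a → 0 ≤ b → b ≤ a + ‖h‖ →
      ρ ^ 2 * (‖h‖ * (a + b)) * Real.exp (-(ρ ^ 2 * a ^ 2))
        ≤ 3 * (ρ * ‖h‖) * Real.exp (-(ρ ^ 2 * a ^ 2 / 2)) := by
    intro a b ha hb hba
    have h1 := mul_exp_neg_sq_le (ρ * a)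
    have h2 : Real.exp (-(ρ ^ 2 * a ^ 2)) ≤ Real.exp (-(ρ ^ 2 * a ^ 2 / 2)) := by
      apply Real.exp_le_exp.2
      have : 0 ≤ ρ ^ 2 * a ^ 2 := by positivity
      linarith
    rw [mul_pow] at h1
    have h3 : ρ * (a + b) ≤ 2 * (ρ * a) + 1 := by nlinarith
    have e0 := Real.exp_pos (-(ρ ^ 2 * a ^ 2))
    calc ρ ^ 2 * (‖h‖ * (a + b)) * Real.exp (-(ρ ^ 2 * a ^ 2))
        = (ρ * ‖h‖) * ((ρ * (a + b)) * Real.exp (-(ρ ^ 2 * a ^ 2))) := by ring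
      _ ≤ (ρ * ‖h‖) * ((2 * (ρ * a) + 1) * Real.exp (-(ρ ^ 2 * a ^ 2))) := by gcongr
      _ ≤ (ρ * ‖h‖) * (3 * Real.exp (-(ρ ^ 2 * a ^ 2 / 2))) := by
          refine mul_le_mul_of_nonneg_left ?_ (by positivity)
          linarith
      _ = _ := by ring
  have hab : ‖x + h‖ ≤ ‖x‖ + ‖h‖ := norm_add_le x h
  have hba : ‖x‖ ≤ ‖x + h‖ + ‖h‖ := by simpa using norm_sub_le (x + h) h
  have hN : 0 ≤ (Real.pi / (4 * t)⁻¹) ^ (-((n : ℝ) / 2)) := by positivity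
  have hdiff : |(4 * t)⁻¹ * ‖x + h‖ ^ 2 - (4 * t)⁻¹ * ‖x‖ ^ 2|
      ≤ ρ ^ 2 * (‖h‖ * (‖x + h‖ + ‖x‖)) := by
    rw [hr, ← mul_sub, abs_mul, abs_of_pos (by positivity : 0 < ρ ^ 2)]
    gcongr
    rw [sq_sub_sq, abs_mul, abs_of_nonneg (by positivity : 0 ≤ ‖x + h‖ + ‖x‖), mul_comm]
    gcongr
    rw [abs_le]; constructor <;> linarith
  rw [mul_add, heatKernel_two_mul ht, heatKernel_two_mul ht, heatKernel, heatKernel, ← mul_sub,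
    abs_mul, abs_of_nonneg hN, neg_mul, neg_mul]
  calc _ ≤ (Real.pi / (4 * t)⁻¹) ^ (-((n : ℝ) / 2)) *
        (ρ ^ 2 * (‖h‖ * (‖x + h‖ + ‖x‖)) * (Real.exp (-((4 * t)⁻¹ * ‖x + h‖ ^ 2))
          + Real.exp (-((4 * t)⁻¹ * ‖x‖ ^ 2)))) := by
        gcongr
        exact (abs_exp_neg_sub_exp_neg_le _ _).trans (by gcongr)
    _ ≤ (Real.pi / (4 * t)⁻¹) ^ (-((n : ℝ) / 2)) *
        (3 * (ρ * ‖h‖) * (Real.exp (-((4 * t)⁻¹ * ‖x + h‖ ^ 2 / 2))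
          + Real.exp (-((4 * t)⁻¹ * ‖x‖ ^ 2 / 2)))) := by
        refine mul_le_mul_of_nonneg_left ?_ hN
        rw [mul_add (ρ ^ 2 * _), mul_add (3 * _), hr]
        refine add_le_add (key _ _ (norm_nonneg _) (norm_nonneg _) hba) ?_
        rw [add_comm ‖x + h‖]
        exact key _ _ (norm_nonneg _) (norm_nonneg _) hab
    _ = _ := by rw [hρ]; ring

theorem integrable_heatKernel_add_sub {n : ℕ} {t : ℝ} (ht : 0 < t)
    (h : EuclideanSpace ℝ (Fin n)) :
    Integrable fun x => heatKernel n t (x + h) - heatKernel n t x :=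
  ((integrable_heatKernel ht).comp_add_right h).sub (integrable_heatKernel ht)

theorem integral_abs_heatKernel_add_sub_le_two {n : ℕ} {t : ℝ} (ht : 0 < t)
    (h : EuclideanSpace ℝ (Fin n)) :
    ∫ x, |heatKernel n t (x + h) - heatKernel n t x| ≤ 2 := by
  have i0 := integrable_heatKernel (n := n) ht
  calc _ ≤ ∫ x, (heatKernel n t (x + h) + heatKernel n t x) := by
        refine integral_mono (integrable_heatKernel_add_sub ht h).abs
          ((i0.comp_add_right h).add i0) fun x => ?_
        have h1 := heatKernel_nonneg ht x
        have h2 := heatKernel_nonneg ht (x + h)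
        simp only []
        rw [abs_le]; constructor <;> linarith
    _ = 2 := by
        rw [integral_add (i0.comp_add_right h) i0, integral_add_right_eq_self (heatKernel n t),
          integral_heatKernel ht]
        norm_num

theorem integral_abs_heatKernel_add_sub_le {n : ℕ} {t : ℝ} (ht : 0 < t)
    (h : EuclideanSpace ℝ (Fin n)) :
    ∫ x, |heatKernel n t (x + h) - heatKernel n t x|
      ≤ 3 * (2 : ℝ) ^ ((n : ℝ) / 2) * (‖h‖ / √t) := by
  have hsq : 0 < √t := Real.sqrt_pos.2 ht
  have h1 : (1 : ℝ) ≤ (2 : ℝ) ^ ((n : ℝ) / 2) :=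
    Real.one_le_rpow (by norm_num) (by positivity)
  rcases le_total ‖h‖ (2 * √t) with hh | hh
  · have i0 := integrable_heatKernel (n := n) (t := 2 * t) (by positivity)
    calc _ ≤ ∫ x, 3 * (‖h‖ / (2 * √t)) * ((2 : ℝ) ^ ((n : ℝ) / 2) *
          (heatKernel n (2 * t) (x + h) + heatKernel n (2 * t) x)) :=
          integral_mono (integrable_heatKernel_add_sub ht h).abs
            ((((i0.comp_add_right h).add i0).const_mul _).const_mul _)
            fun x => abs_heatKernel_add_sub_le ht x h hh
      _ = _ := by
          rw [integral_const_mul, integral_const_mul, integral_add (i0.comp_add_right h) i0,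
            integral_add_right_eq_self (heatKernel n (2 * t)), integral_heatKernel (by positivity)]
          field_simp
          norm_num
  -- For large `h` the trivial bound suffices, since then `‖h‖/√t ≥ 2`.
  · refine (integral_abs_heatKernel_add_sub_le_two ht h).trans ?_
    have h2 : 2 ≤ ‖h‖ / √t := by rwa [le_div_iff₀ hsq]
    nlinarith

/-! ### The `L¹` Hölder estimate and the mass of the Bessel kernel. -/

/-- Restrict the Gamma integral to `(0, 1]`, where `e^(-t) ≥ e^(-1)`. The factor `s` on the right
cancels the `4/σ` of `lintegral_rpow_mul_min_le`, so that the Hölder constant stays bounded as `σ →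
0`. -/
theorem inv_Gamma_half_le {s : ℝ} (hs : 0 < s) :
    (Real.Gamma (s / 2))⁻¹ ≤ Real.exp 1 * (s / 2) := by
  have hs2 := half_pos hs
  rw [inv_le_comm₀ (Real.Gamma_pos_of_pos hs2) (by positivity), Real.Gamma_eq_integral hs2]
  have hi : IntegrableOn (fun t : ℝ => Real.exp (-1) * t ^ (s / 2 - 1)) (Ioc 0 1) := by
    have := (intervalIntegral.intervalIntegrable_rpow' (a := 0) (b := 1)
      (by linarith : -1 < s / 2 - 1)).const_mul (Real.exp (-1))
    rwa [intervalIntegrable_iff_integrableOn_Ioc_of_le zero_le_one] at this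
  calc (Real.exp 1 * (s / 2))⁻¹ = ∫ t in Ioc (0 : ℝ) 1, Real.exp (-1) * t ^ (s / 2 - 1) := by
        rw [← intervalIntegral.integral_of_le zero_le_one, intervalIntegral.integral_const_mul,
          integral_rpow (Or.inl (by linarith)), sub_add_cancel, Real.one_rpow,
          Real.zero_rpow hs2.ne', Real.exp_neg, mul_inv]
        ring
    _ ≤ ∫ t in Ioc (0 : ℝ) 1, Real.exp (-t) * t ^ (s / 2 - 1) := by
        refine setIntegral_mono_on hi ((Real.GammaIntegral_convergent hs2).mono_set
          Ioc_subset_Ioi_self) measurableSet_Ioc fun t ht => ?_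
        have := ht.1
        have := ht.2
        gcongr
    _ ≤ _ := by
        refine setIntegral_mono_set (Real.GammaIntegral_convergent hs2) ?_
          Ioc_subset_Ioi_self.eventuallyLE
        filter_upwards [ae_restrict_mem measurableSet_Ioi] with t ht
        have : (0 : ℝ) < t := ht
        simp only [Pi.zero_apply]
        positivity

/-- The two terms of the minimum balance near `t = a²`. Below it the constant `2` is used,
integrable as `σ > 0`; above it the decaying term, integrable at infinity as `σ < 1`, which is the
source of `1/(1-σ)`. -/
theorem lintegral_rpow_mul_min_le {σ C a : ℝ} (hσ : 0 < σ) (hσ1 : σ < 1) (hC : 0 ≤ C)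
    (ha : 0 < a) :
    ∫⁻ t in Ioi (0 : ℝ), ENNReal.ofReal (t ^ (σ / 2 - 1) * min 2 (C * (a / √t)))
      ≤ ENNReal.ofReal ((4 / σ + 2 * C / (1 - σ)) * a ^ σ) := by
  have ha2 : 0 < a ^ 2 := by positivity
  have p1 : (a ^ 2) ^ (σ / 2) = a ^ σ := by
    rw [← Real.rpow_natCast, ← Real.rpow_mul ha.le]; congr 1; push_cast; ring
  have p2 : a * (a ^ 2) ^ ((σ - 1) / 2) = a ^ σ := by
    rw [← Real.rpow_natCast, ← Real.rpow_mul ha.le]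
    nth_rewrite 1 [← Real.rpow_one a]
    rw [← Real.rpow_add ha]; congr 1; push_cast; ring
  have i1 : IntegrableOn (fun t : ℝ => 2 * t ^ (σ / 2 - 1)) (Ioc 0 (a ^ 2)) := by
    have := (intervalIntegral.intervalIntegrable_rpow' (a := 0) (b := a ^ 2)
      (by linarith : -1 < σ / 2 - 1)).const_mul 2
    rwa [intervalIntegrable_iff_integrableOn_Ioc_of_le ha2.le] at this
  have i2 : IntegrableOn (fun t : ℝ => C * a * t ^ ((σ - 1) / 2 - 1)) (Ioi (a ^ 2)) :=
    (integrableOn_Ioi_rpow_of_lt (by linarith) ha2).const_mul _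
  have v1 : ∫ t in Ioc 0 (a ^ 2), 2 * t ^ (σ / 2 - 1) = 4 / σ * a ^ σ := by
    rw [← intervalIntegral.integral_of_le ha2.le, intervalIntegral.integral_const_mul,
      integral_rpow (Or.inl (by linarith)), sub_add_cancel, p1, Real.zero_rpow (by positivity)]
    field_simp
    ring
  have v2 : ∫ t in Ioi (a ^ 2), C * a * t ^ ((σ - 1) / 2 - 1) = 2 * C / (1 - σ) * a ^ σ := by
    rw [integral_const_mul, integral_Ioi_rpow_of_lt (by linarith) ha2, sub_add_cancel, ← p2]
    have h1 : 1 - σ ≠ 0 := by linarith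
    have h2 : σ - 1 ≠ 0 := by linarith
    field_simp
    ring
  have hσ' : 0 < 1 - σ := by linarith
  rw [← Ioc_union_Ioi_eq_Ioi ha2.le, lintegral_union measurableSet_Ioi
    (Set.disjoint_left.2 fun t h1 h2 => (not_lt.2 h1.2) h2), add_mul,
    ENNReal.ofReal_add (by positivity) (by positivity), ← v1, ← v2,
    ofReal_integral_eq_lintegral_ofReal i1, ofReal_integral_eq_lintegral_ofReal i2]
  · refine add_le_add (setLIntegral_mono' measurableSet_Ioc fun t ht => ?_)
      (setLIntegral_mono' measurableSet_Ioi fun t ht => ?_)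
    · have h0 : 0 < t := ht.1
      apply ENNReal.ofReal_le_ofReal
      rw [mul_comm]
      gcongr
      exact min_le_left _ _
    · have h0 : 0 < t := ha2.trans ht
      apply ENNReal.ofReal_le_ofReal
      have e : t ^ ((σ - 1) / 2 - 1) = t ^ (σ / 2 - 1) * (√t)⁻¹ := by
        rw [Real.sqrt_eq_rpow, ← Real.rpow_neg h0.le, ← Real.rpow_add h0]; congr 1; ring
      rw [e]
      calc t ^ (σ / 2 - 1) * min 2 (C * (a / √t)) ≤ t ^ (σ / 2 - 1) * (C * (a / √t)) := by
            gcongr; exact min_le_right _ _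
        _ = _ := by ring
  · filter_upwards [ae_restrict_mem measurableSet_Ioi] with t ht
    have h0 : 0 < t := ha2.trans ht
    simp only [Pi.zero_apply]
    positivity
  · filter_upwards [ae_restrict_mem measurableSet_Ioc] with t ht
    have h0 : 0 < t := ht.1
    simp only [Pi.zero_apply]
    positivity

theorem lintegral_enorm_subordinatedKernel_add_sub_le {n : ℕ} {σ : ℝ} (hσ : 0 < σ) (hσ1 : σ < 1)
    {h : EuclideanSpace ℝ (Fin n)} (hh : h ≠ 0) :
    ∫⁻ x, ‖subordinatedKernel n σ (x + h) - subordinatedKernel n σ x‖ₑ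
      ≤ ENNReal.ofReal (Real.exp 1 * (2 + 3 * (2 : ℝ) ^ ((n : ℝ) / 2)) / (1 - σ) * ‖h‖ ^ σ) := by
  set C : ℝ := 3 * (2 : ℝ) ^ ((n : ℝ) / 2) with hC
  have hC0 : 0 ≤ C := by positivity
  have hh0 : 0 < ‖h‖ := norm_pos_iff.2 hh
  have hσ' : 0 < 1 - σ := by linarith
  set Γ' : ℝ := (Real.Gamma (σ / 2))⁻¹ with hΓ'
  have hΓ0 : 0 ≤ Γ' := inv_nonneg.2 (Real.Gamma_pos_of_pos (half_pos hσ)).le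
  have hk := integrable_besselIntegrand (n := n) hσ
  -- Integrability in `t` is available only for a.e. `x`; it is needed at both `x` and `x + h` to
  -- subtract under the `t`-integral.
  have hae := hk.prod_left_ae
  have hae' : ∀ᵐ x : EuclideanSpace ℝ (Fin n), Integrable
      (fun t => besselIntegrand n σ (t, x + h)) (volume.restrict (Ioi (0 : ℝ))) :=
    (measurePreserving_add_right volume h).quasiMeasurePreserving.ae hae
  have hmeas : Measurable fun z : EuclideanSpace ℝ (Fin n) × ℝ =>
      besselIntegrand n σ (z.2, z.1 + h) - besselIntegrand n σ (z.2, z.1) := by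
    have := measurable_besselIntegrand n σ
    exact (this.comp (by fun_prop)).sub (this.comp (by fun_prop))
  calc _ ≤ ∫⁻ x, ENNReal.ofReal Γ' * ∫⁻ t in Ioi (0 : ℝ),
        ‖besselIntegrand n σ (t, x + h) - besselIntegrand n σ (t, x)‖ₑ := by
        refine lintegral_mono_ae ?_
        filter_upwards [hae, hae'] with x h1 h2
        rw [subordinatedKernel, subordinatedKernel, ← mul_sub, ← integral_sub h2 h1, enorm_mul,
          Real.enorm_of_nonneg hΓ0]
        gcongr
        exact enorm_integral_le_lintegral_enorm _
    _ = ENNReal.ofReal Γ' * ∫⁻ t in Ioi (0 : ℝ), ∫⁻ x,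
        ‖besselIntegrand n σ (t, x + h) - besselIntegrand n σ (t, x)‖ₑ := by
        rw [lintegral_const_mul' _ _ ENNReal.ofReal_ne_top, lintegral_lintegral_swap]
        exact hmeas.enorm.aemeasurable
    _ ≤ ENNReal.ofReal Γ' * ∫⁻ t in Ioi (0 : ℝ),
          ENNReal.ofReal (t ^ (σ / 2 - 1) * min 2 (C * (‖h‖ / √t))) := by
        gcongr ENNReal.ofReal Γ' * ?_
        refine setLIntegral_mono' measurableSet_Ioi fun t ht => ?_
        have ht0 : 0 < t := ht
        have e : ∀ x, ‖besselIntegrand n σ (t, x + h) - besselIntegrand n σ (t, x)‖ₑ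
            = ENNReal.ofReal (t ^ (σ / 2 - 1) * Real.exp (-(1 * t)) *
              |heatKernel n t (x + h) - heatKernel n t x|) := fun x => by
          simp only [besselIntegrand]
          rw [← mul_sub, Real.enorm_eq_ofReal_abs, abs_mul, abs_of_nonneg (by positivity)]
        simp only [e]
        rw [← ofReal_integral_eq_lintegral_ofReal
          ((integrable_heatKernel_add_sub ht0 h).abs.const_mul _)
          (Eventually.of_forall fun x => by positivity), integral_const_mul]
        apply ENNReal.ofReal_le_ofReal
        have h1 : Real.exp (-(1 * t)) ≤ 1 := Real.exp_le_one_iff.2 (by linarith)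
        have h2 : 0 ≤ ∫ x, |heatKernel n t (x + h) - heatKernel n t x| :=
          integral_nonneg fun x => abs_nonneg _
        calc _ ≤ t ^ (σ / 2 - 1) * 1 * ∫ x, |heatKernel n t (x + h) - heatKernel n t x| := by
              gcongr
          _ ≤ _ := by
              rw [mul_one]
              gcongr
              exact le_min (integral_abs_heatKernel_add_sub_le_two ht0 h)
                (integral_abs_heatKernel_add_sub_le ht0 h)
    _ ≤ ENNReal.ofReal Γ' * ENNReal.ofReal ((4 / σ + 2 * C / (1 - σ)) * ‖h‖ ^ σ) := by
        gcongr
        exact lintegral_rpow_mul_min_le hσ hσ1 hC0 hh0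
    _ ≤ _ := by
        rw [← ENNReal.ofReal_mul hΓ0]
        apply ENNReal.ofReal_le_ofReal
        rw [← mul_assoc]
        gcongr ?_ * _
        calc Γ' * (4 / σ + 2 * C / (1 - σ))
            ≤ Real.exp 1 * (σ / 2) * (4 / σ + 2 * C / (1 - σ)) := by
              gcongr; exact inv_Gamma_half_le hσ
          _ = Real.exp 1 * (2 * (1 - σ) + C * σ) / (1 - σ) := by field_simp; ring
          _ ≤ _ := by gcongr <;> nlinarith

/-- The constant in the `L¹` Hölder estimate for translates of the Bessel kernel. -/
noncomputable def besselHolderConst (n : ℕ) : ℝ := Real.exp 1 * (2 + 3 * (2 : ℝ) ^ ((n : ℝ) / 2))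

theorem besselHolderConst_pos (n : ℕ) : 0 < besselHolderConst n := by
  unfold besselHolderConst; positivity

theorem integral_abs_besselKernel_add_sub_le {n : ℕ} {σ : ℝ} (hσ : 0 < σ) (hσ1 : σ < 1)
    (h : EuclideanSpace ℝ (Fin n)) :
    ∫ x, |besselKernel n σ (x + h) - besselKernel n σ x|
      ≤ besselHolderConst n / (1 - σ) * ‖h‖ ^ σ := by
  have hσ' : 0 < 1 - σ := by linarith
  have hc := besselHolderConst_pos n
  rcases eq_or_ne h 0 with rfl | hh
  · simp only [add_zero, sub_self, abs_zero, integral_zero]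
    positivity
  have hae := (isBesselKernel_besselKernel n hσ).ae_eq (isBesselKernel_subordinatedKernel hσ)
  have hae' : ∀ᵐ x, besselKernel n σ (x + h) = subordinatedKernel n σ (x + h) :=
    (measurePreserving_add_right volume h).quasiMeasurePreserving.ae hae
  have i0 := (isBesselKernel_besselKernel n hσ).1
  have i1 : Integrable fun x => |besselKernel n σ (x + h) - besselKernel n σ x| :=
    ((i0.comp_add_right h).sub i0).abs
  rw [integral_eq_lintegral_of_nonneg_ae (Eventually.of_forall fun x => abs_nonneg _)
    i1.aestronglyMeasurable]
  refine ENNReal.toReal_le_of_le_ofReal (by positivity) ?_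
  refine le_trans (le_of_eq (lintegral_congr_ae ?_))
    (lintegral_enorm_subordinatedKernel_add_sub_le hσ hσ1 hh)
  filter_upwards [hae, hae'] with x h1 h2
  rw [← h1, ← h2, Real.enorm_eq_ofReal_abs]

/-- The kernel is a.e. nonnegative by subordination, so its `L¹` norm is its Fourier transform at
`0`. -/
theorem integral_abs_besselKernel {n : ℕ} {σ : ℝ} (hσ : 0 < σ) :
    ∫ x, |besselKernel n σ x| = 1 := by
  have hk := isBesselKernel_besselKernel n hσ
  have hae := hk.ae_eq (isBesselKernel_subordinatedKernel hσ)
  have h1 : ∫ x, |besselKernel n σ x| = ∫ x, besselKernel n σ x := by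
    refine integral_congr_ae ?_
    filter_upwards [hae] with x hx
    rw [hx, abs_of_nonneg]
    refine mul_nonneg (inv_nonneg.2 (Real.Gamma_pos_of_pos (half_pos hσ)).le)
      (setIntegral_nonneg measurableSet_Ioi fun t ht => ?_)
    have := heatKernel_nonneg ht x
    have : (0 : ℝ) < t := ht
    simp only [besselIntegrand]
    positivity
  have h2 := hk.2 0
  rw [h1, ← Complex.ofReal_inj, ← integral_complex_ofReal]
  simpa [Real.fourier_eq] using h2

/-! ### Young functions, Jensen's inequality and convolution. -/

namespace IsYoungFunction

variable {A : ℝ → ℝ}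

theorem nonneg (hA : IsYoungFunction A) {t : ℝ} (ht : 0 ≤ t) : 0 ≤ A t := by
  rw [← hA.map_zero]
  exact hA.mono self_mem_Ici ht ht

theorem apply_le_apply (hA : IsYoungFunction A) {a b : ℝ} (ha : 0 ≤ a) (hab : a ≤ b) :
    A a ≤ A b :=
  hA.mono ha (ha.trans hab) hab

theorem apply_mul_le (hA : IsYoungFunction A) {θ t : ℝ} (h0 : 0 ≤ θ) (h1 : θ ≤ 1) (ht : 0 ≤ t) :
    A (θ * t) ≤ θ * A t := by
  have := hA.convex.2 (show t ∈ Ici (0 : ℝ) from ht) (self_mem_Ici (a := (0 : ℝ))) h0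
    (sub_nonneg.2 h1) (by ring)
  simpa [hA.map_zero] using this

theorem continuousOn (hA : IsYoungFunction A) : ContinuousOn A (Ici 0) := by
  intro t ht
  rcases eq_or_lt_of_le (show (0 : ℝ) ≤ t from ht) with rfl | ht0
  · rw [← continuousWithinAt_Ioi_iff_Ici, ContinuousWithinAt, hA.map_zero]
    have h1 : Tendsto (fun t : ℝ => A t / t * t) (𝓝[>] 0) (𝓝 (0 * 0)) :=
      hA.superlinear_zero.mul (tendsto_id.mono_left nhdsWithin_le_nhds)
    rw [mul_zero] at h1
    refine h1.congr' ?_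
    filter_upwards [self_mem_nhdsWithin] with t ht
    exact div_mul_cancel₀ _ (ne_of_gt ht)
  · have h1 := hA.convex.continuousOn_interior
    rw [interior_Ici] at h1
    exact (h1.continuousAt (Ioi_mem_nhds ht0)).continuousWithinAt

theorem measurable_comp_abs (hA : IsYoungFunction A) : Measurable fun t => A |t| := by
  have h : Monotone fun t => A (max t 0) := fun a b hab =>
    hA.apply_le_apply (le_max_right _ _) (max_le_max_right 0 hab)
  have h2 : (fun t => A |t|) = (fun t => A (max t 0)) ∘ fun t => |t| := by
    funext t; simp
  rw [h2]
  exact h.measurable.comp (by fun_prop)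

/-- Superlinearity at infinity places `L^A` inside `L^∞ + L¹`, which makes convolution with an
integrable kernel meaningful. -/
theorem exists_le_add (hA : IsYoungFunction A) : ∃ c, 0 ≤ c ∧ ∀ t, 0 ≤ t → t ≤ c + A t := by
  obtain ⟨c, hc⟩ := eventually_atTop.1 (hA.superlinear_top.eventually_ge_atTop 1)
  refine ⟨max c 1, by positivity, fun t ht => ?_⟩
  rcases le_total t (max c 1) with h | h
  · linarith [hA.nonneg ht]
  · have h1 := hc t ((le_max_left _ _).trans h)
    have h2 : 0 < t := one_pos.trans_le ((le_max_right _ _).trans h)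
    rw [le_div_iff₀ h2] at h1
    have : 0 ≤ max c 1 := by positivity
    linarith

/-- Jensen's inequality for integrals against a kernel of finite mass. -/
theorem ofReal_apply_abs_integral_le (hA : IsYoungFunction A) {n : ℕ}
    {k φ : EuclideanSpace ℝ (Fin n) → ℝ} (hk : Integrable k) (hφ : AEStronglyMeasurable φ)
    {a : ℝ} (ha : 0 ≤ a) :
    ENNReal.ofReal (A (a * |∫ y, k y * φ y|)) ≤
      ∫⁻ y, ENNReal.ofReal (|k y| / ∫ z, |k z|) *
        ENNReal.ofReal (A (((∫ z, |k z|) * a) * |φ y|)) := by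
  set D : ℝ := ∫ z, |k z| with hD
  have hD0 : 0 ≤ D := integral_nonneg fun z => abs_nonneg _
  -- Without integrability the integral on the left is `0` by convention, and `A 0 = 0`.
  by_cases hkφ : Integrable fun y => k y * φ y
  swap
  · rw [integral_undef hkφ]
    simp [hA.map_zero]
  rcases eq_or_lt_of_le hD0 with hD1 | hD1
  · have h0 := (integral_eq_zero_iff_of_nonneg (fun z => abs_nonneg (k z)) hk.abs).1 hD1.symm
    have h1 : ∫ y, k y * φ y = 0 := by
      refine integral_eq_zero_of_ae ?_
      filter_upwards [h0] with y hy
      have : k y = 0 := by simpa using hy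
      simp [this]
    simp [h1, hA.map_zero]
  set w : EuclideanSpace ℝ (Fin n) → ℝ≥0∞ := fun y => ENNReal.ofReal (|k y| / D) with hw
  set Ψ : EuclideanSpace ℝ (Fin n) → ℝ := fun y => D * a * |φ y| with hΨ
  have hΨ0 : ∀ y, 0 ≤ Ψ y := fun y => by positivity
  have hwm : AEMeasurable w :=
    (hk.abs.aestronglyMeasurable.aemeasurable.div_const D).ennreal_ofReal
  have hwt : ∀ y, (w y).toReal = |k y| / D := fun y => ENNReal.toReal_ofReal (by positivity)
  have hwf : ∀ᵐ y, w y < ∞ := Eventually.of_forall fun y => ENNReal.ofReal_lt_top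
  have hφm : AEMeasurable φ := hφ.aemeasurable
  have hAΨ : (fun y => A (Ψ y)) = fun y => A |D * a * φ y| := by
    funext y
    rw [hΨ, abs_mul, abs_of_nonneg (by positivity : 0 ≤ D * a)]
  have hAm : AEMeasurable fun y => A (Ψ y) := by
    rw [hAΨ]
    exact hA.measurable_comp_abs.comp_aemeasurable (hφm.const_mul _)
  set μ := volume.withDensity w with hμ
  have hac : μ ≪ volume := withDensity_absolutelyContinuous _ _
  have hprob : IsProbabilityMeasure μ := by
    constructor
    rw [hμ, withDensity_apply _ MeasurableSet.univ, Measure.restrict_univ, hw,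
      ← ofReal_integral_eq_lintegral_ofReal (hk.abs.div_const D)
        (Eventually.of_forall fun y => by positivity), integral_div, div_self hD1.ne']
    simp
  have hΨi : Integrable Ψ μ := by
    rw [hμ, integrable_withDensity_iff_integrable_smul₀' hwm hwf]
    refine (hkφ.abs.const_mul a).congr (Eventually.of_forall fun y => ?_)
    simp only [hwt, smul_eq_mul, hΨ, abs_mul]
    field_simp
  have hΨv : ∫ y, Ψ y ∂μ = a * ∫ y, |k y * φ y| := by
    rw [hμ, integral_withDensity_eq_integral_toReal_smul₀ hwm hwf, ← integral_const_mul]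
    refine integral_congr_ae (Eventually.of_forall fun y => ?_)
    simp only [hwt, smul_eq_mul, hΨ, abs_mul]
    field_simp
  have hR : ∫⁻ y, w y * ENNReal.ofReal (A (Ψ y)) = ∫⁻ y, ENNReal.ofReal (A (Ψ y)) ∂μ := by
    rw [hμ, lintegral_withDensity_eq_lintegral_mul₀ hwm hAm.ennreal_ofReal]
    rfl
  change _ ≤ ∫⁻ y, w y * ENNReal.ofReal (A (Ψ y))
  rw [hR]
  by_cases hfin : ∫⁻ y, ENNReal.ofReal (A (Ψ y)) ∂μ = ∞
  · rw [hfin]; exact le_top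
  have hAi : Integrable (A ∘ Ψ) μ := by
    refine ⟨(hAm.mono_ac hac).aestronglyMeasurable, ?_⟩
    change HasFiniteIntegral (fun y => A (Ψ y)) μ
    rw [hasFiniteIntegral_iff_ofReal (Eventually.of_forall fun y => hA.nonneg (hΨ0 y))]
    exact lt_top_iff_ne_top.2 hfin
  have hJ := hA.convex.map_integral_le hA.continuousOn isClosed_Ici
    (Eventually.of_forall fun y => hΨ0 y) hΨi hAi
  have hJ2 := ofReal_integral_eq_lintegral_ofReal hAi
    (Eventually.of_forall fun y => hA.nonneg (hΨ0 y))
  simp only [Function.comp_apply] at hJ2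
  rw [← hJ2]
  refine ENNReal.ofReal_le_ofReal (le_trans ?_ hJ)
  rw [hΨv]
  refine hA.apply_le_apply (by positivity) ?_
  gcongr
  exact abs_integral_le_integral_abs

/-- Young's inequality for convolutions, in modular form. -/
theorem lintegral_apply_abs_convolution_le (hA : IsYoungFunction A) {n : ℕ}
    {k f : EuclideanSpace ℝ (Fin n) → ℝ} (hk : Integrable k) (hf : AEStronglyMeasurable f)
    {a b : ℝ} (ha : 0 ≤ a) (hb : (∫ z, |k z|) * a ≤ b) :
    ∫⁻ x, ENNReal.ofReal (A (a * |∫ y, k y * f (x - y)|)) ≤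
      ∫⁻ x, ENNReal.ofReal (A (b * |f x|)) := by
  set D : ℝ := ∫ z, |k z| with hD
  have hD0 : 0 ≤ D := integral_nonneg fun z => abs_nonneg _
  have hqmp := quasiMeasurePreserving_sub_of_right_invariant
    (volume : Measure (EuclideanSpace ℝ (Fin n))) volume
  have hwm : AEMeasurable fun y => ENNReal.ofReal (|k y| / D) :=
    (hk.abs.aestronglyMeasurable.aemeasurable.div_const D).ennreal_ofReal
  have hAe : ∀ t, A (D * a * |t|) = A |D * a * t| := fun t => by
    rw [abs_mul, abs_of_nonneg (by positivity : 0 ≤ D * a)]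
  have hm : AEMeasurable (fun p : EuclideanSpace ℝ (Fin n) × EuclideanSpace ℝ (Fin n) =>
      ENNReal.ofReal (|k p.2| / D) * ENNReal.ofReal (A (D * a * |f (p.1 - p.2)|)))
      (volume.prod volume) := by
    refine (hwm.comp_quasiMeasurePreserving Measure.quasiMeasurePreserving_snd).mul ?_
    simp only [hAe]
    exact (hA.measurable_comp_abs.comp_aemeasurable
      ((hf.comp_quasiMeasurePreserving hqmp).aemeasurable.const_mul _)).ennreal_ofReal
  calc _ ≤ ∫⁻ x, ∫⁻ y, ENNReal.ofReal (|k y| / D) *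
        ENNReal.ofReal (A (D * a * |f (x - y)|)) :=
        lintegral_mono fun x => hA.ofReal_apply_abs_integral_le hk
          (hf.comp_quasiMeasurePreserving (quasiMeasurePreserving_sub_left_of_right_invariant
            volume x)) ha
    _ = ∫⁻ y, ∫⁻ x, ENNReal.ofReal (|k y| / D) *
        ENNReal.ofReal (A (D * a * |f (x - y)|)) := lintegral_lintegral_swap hm
    _ = ∫⁻ y, ENNReal.ofReal (|k y| / D) *
        ∫⁻ x, ENNReal.ofReal (A (D * a * |f x|)) := by
        refine lintegral_congr fun y => ?_
        rw [lintegral_const_mul' _ _ ENNReal.ofReal_ne_top,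
          lintegral_sub_right_eq_self (fun x => ENNReal.ofReal (A (D * a * |f x|)))]
    _ = (∫⁻ y, ENNReal.ofReal (|k y| / D)) *
        ∫⁻ x, ENNReal.ofReal (A (D * a * |f x|)) := lintegral_mul_const'' _ hwm
    _ ≤ 1 * ∫⁻ x, ENNReal.ofReal (A (D * a * |f x|)) := by
        gcongr
        rw [← ofReal_integral_eq_lintegral_ofReal (hk.abs.div_const D)
          (Eventually.of_forall fun y => by positivity), integral_div]
        -- The total weight is `D / D`, which is `0` rather than `1` when `k` vanishes a.e.
        exact ENNReal.ofReal_le_one.2 (div_self_le_one _)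
    _ ≤ _ := by
        rw [one_mul]
        refine lintegral_mono fun x => ENNReal.ofReal_le_ofReal ?_
        exact hA.apply_le_apply (by positivity) (by gcongr)

/-- By `exists_le_add`, `|f|` is at most a constant plus an integrable function, and both convolve
with `L¹`. -/
theorem ae_integrable_convolution (hA : IsYoungFunction A) {n : ℕ}
    {k f : EuclideanSpace ℝ (Fin n) → ℝ} (hk : Integrable k) (hf : f ∈ orliczSpace n A) :
    ∀ᵐ x, Integrable fun y => k y * f (x - y) := by
  obtain ⟨hfm, t, ht, hft⟩ := hf
  obtain ⟨c, hc, hcA⟩ := hA.exists_le_add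
  set F : EuclideanSpace ℝ (Fin n) → ℝ := fun x => A |f x / t| with hF
  have hFi : Integrable F := by
    refine ⟨(hA.measurable_comp_abs.comp_aemeasurable
      (hfm.aemeasurable.div_const t)).aestronglyMeasurable, ?_⟩
    rw [hasFiniteIntegral_iff_ofReal (Eventually.of_forall fun y => hA.nonneg (abs_nonneg _))]
    exact hft
  filter_upwards [hk.ae_convolution_exists (ContinuousLinearMap.mul ℝ ℝ) hFi] with x hx
  have hx' : Integrable fun y => k y * F (x - y) := hx
  refine ((hk.abs.const_mul (t * c)).add (hx'.abs.const_mul t)).mono'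
    (hk.aestronglyMeasurable.mul (hfm.comp_quasiMeasurePreserving
      (quasiMeasurePreserving_sub_left_of_right_invariant volume x)))
    (Eventually.of_forall fun y => ?_)
  have h1 : |f (x - y) / t| ≤ c + F (x - y) := hcA _ (abs_nonneg _)
  have hF0 : 0 ≤ F (x - y) := hA.nonneg (abs_nonneg _)
  have h2 : |f (x - y)| ≤ t * (c + F (x - y)) := by
    rwa [abs_div, abs_of_pos ht, div_le_iff₀ ht, mul_comm] at h1
  simp only [Pi.add_apply]
  rw [Real.norm_eq_abs, abs_mul, abs_mul, abs_of_nonneg hF0]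
  calc |k y| * |f (x - y)| ≤ |k y| * (t * (c + F (x - y))) := by gcongr
    _ = _ := by ring

end IsYoungFunction

/-! ### Modular estimates for Bessel potentials. -/

theorem besselPotential_add_sub_ae_eq {A : ℝ → ℝ} (hA : IsYoungFunction A) {n : ℕ} {σ : ℝ}
    (hσ : 0 < σ) {f : EuclideanSpace ℝ (Fin n) → ℝ} (hf : f ∈ orliczSpace n A)
    (h : EuclideanSpace ℝ (Fin n)) :
    ∀ᵐ x, besselPotential σ f (x + h) - besselPotential σ f x
      = ∫ y, (besselKernel n σ (y + h) - besselKernel n σ y) * f (x - y) := by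
  have hk := (isBesselKernel_besselKernel n hσ).1
  filter_upwards [hA.ae_integrable_convolution hk hf,
    hA.ae_integrable_convolution (hk.comp_add_right h) hf] with x h1 h2
  have e : besselPotential σ f (x + h) = ∫ y, besselKernel n σ (y + h) * f (x - y) := by
    simp only [besselPotential, convolution_def, ContinuousLinearMap.mul_apply']
    rw [← integral_add_right_eq_self _ h]
    simp only [add_sub_add_right_eq_sub]
  simp only [sub_mul]
  rw [e, integral_sub h2 h1]
  rfl

theorem lintegral_gagliardo_weight {n : ℕ} (hn : 1 ≤ n) {s σ : ℝ} (hs : 0 < s) (hsσ : s < σ) :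
    ∫⁻ h : EuclideanSpace ℝ (Fin n),
        ENNReal.ofReal ((if ‖h‖ < 1 then ‖h‖ ^ (σ - s) else ‖h‖ ^ (-s)) / ‖h‖ ^ n)
      = ENNReal.ofReal (n * volume.real (Metric.ball (0 : EuclideanSpace ℝ (Fin n)) 1)
          * (1 / (σ - s) + 1 / s)) := by
  have : Nontrivial (EuclideanSpace ℝ (Fin n)) := by
    have : Nonempty (Fin n) := ⟨⟨0, hn⟩⟩
    infer_instance
  set ψ : ℝ → ℝ := fun r => (if r < 1 then r ^ (σ - s) else r ^ (-s)) / r ^ n with hψ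
  have hδ : 0 < σ - s := sub_pos.2 hsσ
  have hpow : ∀ (r p : ℝ), 0 < r → r ^ (n - 1) • (r ^ p / r ^ n) = r ^ (p - 1) := by
    intro r p hr
    rw [smul_eq_mul, Real.rpow_sub_one hr.ne']
    have : r ^ n = r ^ (n - 1) * r := by rw [← pow_succ, Nat.sub_add_cancel hn]
    rw [this]
    field_simp
  have e1 : EqOn (fun r : ℝ => r ^ (σ - s - 1)) (fun r => r ^ (n - 1) • ψ r) (Ioo 0 1) := by
    intro r hr
    simp only [hψ, if_pos hr.2]
    exact (hpow r _ hr.1).symm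
  have e2 : EqOn (fun r : ℝ => r ^ (-s - 1)) (fun r => r ^ (n - 1) • ψ r) (Ici 1) := by
    intro r hr
    simp only [hψ, if_neg (not_lt.2 (show 1 ≤ r from hr))]
    exact (hpow r _ (one_pos.trans_le hr)).symm
  have i1' : IntegrableOn (fun r : ℝ => r ^ (σ - s - 1)) (Ioc 0 1) := by
    have := intervalIntegral.intervalIntegrable_rpow' (a := 0) (b := 1)
      (by linarith : -1 < σ - s - 1)
    rwa [intervalIntegrable_iff_integrableOn_Ioc_of_le zero_le_one] at this
  have i1 := (i1'.mono_set Ioo_subset_Ioc_self).congr_fun e1 measurableSet_Ioo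
  have i2 := ((integrableOn_Ici_iff_integrableOn_Ioi (μ := volume)).2
    (integrableOn_Ioi_rpow_of_lt (by linarith : -s - 1 < -1) one_pos)).congr_fun e2
    measurableSet_Ici
  have hun : Ioo (0 : ℝ) 1 ∪ Ici 1 = Ioi 0 := Ioo_union_Ici_eq_Ioi one_pos
  have hdis : Disjoint (Ioo (0 : ℝ) 1) (Ici 1) :=
    Set.disjoint_left.2 fun t h1 h2 => (not_lt.2 h2) h1.2
  have i3 : IntegrableOn (fun r => r ^ (n - 1) • ψ r) (Ioi 0) := by
    rw [← hun]; exact i1.union i2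
  have v : ∫ r in Ioi (0 : ℝ), r ^ (n - 1) • ψ r = 1 / (σ - s) + 1 / s := by
    rw [← hun, setIntegral_union hdis measurableSet_Ici i1 i2, ← setIntegral_congr_fun measurableSet_Ioo e1,
      ← setIntegral_congr_fun measurableSet_Ici e2, integral_Ici_eq_integral_Ioi,
      integral_Ioi_rpow_of_lt (by linarith) one_pos, ← integral_Ioc_eq_integral_Ioo,
      ← intervalIntegral.integral_of_le zero_le_one, integral_rpow (Or.inl (by linarith))]
    simp [Real.zero_rpow hδ.ne', neg_div_neg_eq]
  have hfr : Module.finrank ℝ (EuclideanSpace ℝ (Fin n)) = n := by simp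
  have hi : Integrable fun h : EuclideanSpace ℝ (Fin n) => ψ ‖h‖ := by
    rw [integrable_fun_norm_addHaar, hfr]; exact i3
  have hψ0 : ∀ h : EuclideanSpace ℝ (Fin n), 0 ≤ ψ ‖h‖ := fun h => by
    simp only [hψ]; split_ifs <;> positivity
  change ∫⁻ h : EuclideanSpace ℝ (Fin n), ENNReal.ofReal (ψ ‖h‖) = _
  rw [← ofReal_integral_eq_lintegral_ofReal hi (Eventually.of_forall hψ0),
    integral_fun_norm_addHaar, hfr, v, nsmul_eq_mul, smul_eq_mul, mul_assoc]

theorem lintegral_apply_besselPotential_le {A : ℝ → ℝ} (hA : IsYoungFunction A) {n : ℕ} {σ : ℝ}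
    (hσ : 0 < σ) {f u : EuclideanSpace ℝ (Fin n) → ℝ} (hf : f ∈ orliczSpace n A)
    (hu : u =ᵐ[volume] besselPotential σ f) :
    ∫⁻ x, ENNReal.ofReal (A |u x|) ≤
      ∫⁻ x, ENNReal.ofReal (A ((∫ z, |besselKernel n σ z|) * |f x|)) := by
  have h := hA.lintegral_apply_abs_convolution_le (isBesselKernel_besselKernel n hσ).1 hf.1
    zero_le_one (mul_one _).le
  refine le_trans (le_of_eq (lintegral_congr_ae ?_)) h
  filter_upwards [hu] with x hx
  rw [hx, one_mul]
  rfl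

theorem lintegral_lintegral_difference_besselPotential_le {A : ℝ → ℝ} (hA : IsYoungFunction A)
    {n : ℕ} (hn : 1 ≤ n) {s σ : ℝ} (hs : 0 < s) (hsσ : s < σ) (hσ1 : σ < 1)
    {f u : EuclideanSpace ℝ (Fin n) → ℝ} (hf : f ∈ orliczSpace n A)
    (hu : u =ᵐ[volume] besselPotential σ f) :
    ∫⁻ h, ∫⁻ x, ENNReal.ofReal (A (|u (x + h) - u x| / ‖h‖ ^ s) / ‖h‖ ^ n) ≤
      ENNReal.ofReal (n * volume.real (Metric.ball (0 : EuclideanSpace ℝ (Fin n)) 1)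
          * (1 / (σ - s) + 1 / s)) *
        ∫⁻ x, ENNReal.ofReal (A ((2 * (∫ z, |besselKernel n σ z|)
          + besselHolderConst n / (1 - σ)) * |f x|)) := by
  have hσ : 0 < σ := hs.trans hsσ
  have hσ' : 0 < 1 - σ := by linarith
  have hk := (isBesselKernel_besselKernel n hσ).1
  set N : ℝ := ∫ z, |besselKernel n σ z| with hN
  have hN0 : 0 ≤ N := integral_nonneg fun z => abs_nonneg _
  set M : ℝ := besselHolderConst n / (1 - σ) with hM
  have hM0 : 0 ≤ M := div_nonneg (besselHolderConst_pos n).le hσ'.le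
  set θ : EuclideanSpace ℝ (Fin n) → ℝ := fun h =>
    if ‖h‖ < 1 then ‖h‖ ^ (σ - s) else ‖h‖ ^ (-s) with hθ
  have hθm : Measurable θ :=
    Measurable.ite (measurableSet_lt measurable_norm measurable_const) (by fun_prop) (by fun_prop)
  have hθ0 : ∀ h, 0 ≤ θ h := fun h => by simp only [hθ]; split_ifs <;> positivity
  have hθ1 : ∀ h, θ h ≤ 1 := fun h => by
    simp only [hθ]
    split_ifs with h1
    · exact Real.rpow_le_one (norm_nonneg _) h1.le (by linarith)
    · exact Real.rpow_le_one_of_one_le_of_nonpos (not_lt.1 h1) (by linarith)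
  -- For `‖h‖ < 1` the Hölder bound `M‖h‖^σ` is used, otherwise the triangle inequality with mass
  -- `2N`; the sum `2N + M` serves both ranges.
  have hD : ∀ h : EuclideanSpace ℝ (Fin n), h ≠ 0 →
      (∫ x, |besselKernel n σ (x + h) - besselKernel n σ x|) * (‖h‖ ^ s)⁻¹
        ≤ θ h * (2 * N + M) := by
    intro h hh
    have hh0 : 0 < ‖h‖ := norm_pos_iff.2 hh
    have hp := Real.rpow_pos_of_pos hh0
    simp only [hθ]
    split_ifs with h1
    · have e : ‖h‖ ^ (σ - s) = ‖h‖ ^ σ * (‖h‖ ^ s)⁻¹ := by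
        rw [Real.rpow_sub hh0, div_eq_mul_inv]
      rw [e, mul_comm (‖h‖ ^ σ * _), ← mul_assoc]
      have := hp s
      have h2 := hp σ
      gcongr
      refine (integral_abs_besselKernel_add_sub_le hσ hσ1 h).trans ?_
      rw [← hM]
      gcongr
      linarith
    · rw [Real.rpow_neg hh0.le, mul_comm]
      have := hp s
      gcongr
      calc _ ≤ ∫ x, (|besselKernel n σ (x + h)| + |besselKernel n σ x|) :=
            integral_mono ((hk.comp_add_right h).sub hk).abs
              ((hk.comp_add_right h).abs.add hk.abs) fun x => abs_sub _ _
        _ = 2 * N := by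
            rw [integral_add (hk.comp_add_right h).abs hk.abs,
              integral_add_right_eq_self (fun x => |besselKernel n σ x|)]
            ring
        _ ≤ _ := by linarith
  set I : ℝ≥0∞ := ∫⁻ x, ENNReal.ofReal (A ((2 * N + M) * |f x|)) with hI
  have : Nonempty (Fin n) := ⟨⟨0, hn⟩⟩
  have hinner : ∀ᵐ h : EuclideanSpace ℝ (Fin n),
      ∫⁻ x, ENNReal.ofReal (A (|u (x + h) - u x| / ‖h‖ ^ s) / ‖h‖ ^ n)
        ≤ ENNReal.ofReal (θ h / ‖h‖ ^ n) * I := by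
    filter_upwards [Measure.ae_ne volume (0 : EuclideanSpace ℝ (Fin n))] with h hh
    have hh0 : 0 < ‖h‖ := norm_pos_iff.2 hh
    have hps := Real.rpow_pos_of_pos hh0 s
    have hu' : ∀ᵐ x, u (x + h) = besselPotential σ f (x + h) :=
      (measurePreserving_add_right volume h).quasiMeasurePreserving.ae hu
    calc _ = ∫⁻ x, ENNReal.ofReal (‖h‖ ^ n)⁻¹ * ENNReal.ofReal (A ((‖h‖ ^ s)⁻¹ *
          |∫ y, (besselKernel n σ (y + h) - besselKernel n σ y) * f (x - y)|)) := by
          refine lintegral_congr_ae ?_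
          filter_upwards [hu, hu', besselPotential_add_sub_ae_eq hA hσ hf h] with x h1 h2 h3
          rw [h1, h2, h3, div_eq_inv_mul, div_eq_inv_mul, ENNReal.ofReal_mul (by positivity)]
      _ ≤ ENNReal.ofReal (‖h‖ ^ n)⁻¹ *
          ∫⁻ x, ENNReal.ofReal (A (θ h * (2 * N + M) * |f x|)) := by
          rw [lintegral_const_mul' _ _ ENNReal.ofReal_ne_top]
          gcongr _ * ?_
          exact hA.lintegral_apply_abs_convolution_le ((hk.comp_add_right h).sub hk) hf.1
            (by positivity) (hD h hh)
      _ ≤ ENNReal.ofReal (‖h‖ ^ n)⁻¹ * (ENNReal.ofReal (θ h) * I) := by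
          rw [hI, ← lintegral_const_mul' (ENNReal.ofReal (θ h)) _ ENNReal.ofReal_ne_top]
          refine mul_le_mul_right (lintegral_mono fun x => ?_) _
          rw [← ENNReal.ofReal_mul (hθ0 h), mul_assoc]
          exact ENNReal.ofReal_le_ofReal (hA.apply_mul_le (hθ0 h) (hθ1 h) (by positivity))
      _ = _ := by
          rw [← mul_assoc, ← ENNReal.ofReal_mul (by positivity), inv_mul_eq_div]
  calc _ ≤ ∫⁻ h, ENNReal.ofReal (θ h / ‖h‖ ^ n) * I := lintegral_mono_ae hinner
    _ = (∫⁻ h, ENNReal.ofReal (θ h / ‖h‖ ^ n)) * I :=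
        lintegral_mul_const _ (hθm.div (by fun_prop)).ennreal_ofReal
    _ = _ := by rw [lintegral_gagliardo_weight hn hs hsσ]

/-- Translation `x ↦ x + y` followed by Tonelli. -/
theorem gagliardoModular_eq {A : ℝ → ℝ} (hA : IsYoungFunction A) {n : ℕ} (s : ℝ)
    {u : EuclideanSpace ℝ (Fin n) → ℝ} (hu : AEStronglyMeasurable u) :
    gagliardoModular A s u =
      ∫⁻ h, ∫⁻ x, ENNReal.ofReal (A (|u (x + h) - u x| / ‖h‖ ^ s) / ‖h‖ ^ n) := by
  have hm : AEMeasurable (fun p : EuclideanSpace ℝ (Fin n) × EuclideanSpace ℝ (Fin n) =>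
      ENNReal.ofReal (A (|u (p.1 + p.2) - u p.1| / ‖p.2‖ ^ s) / ‖p.2‖ ^ n))
      (volume.prod volume) := by
    have e : ∀ p : EuclideanSpace ℝ (Fin n) × EuclideanSpace ℝ (Fin n),
        A (|u (p.1 + p.2) - u p.1| / ‖p.2‖ ^ s)
          = A |(u (p.1 + p.2) - u p.1) / ‖p.2‖ ^ s| := fun p => by
      rw [abs_div, abs_of_nonneg (by positivity : 0 ≤ ‖p.2‖ ^ s)]
    simp only [e]
    have h1 : AEMeasurable (fun p : EuclideanSpace ℝ (Fin n) × EuclideanSpace ℝ (Fin n) =>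
        u (p.1 + p.2)) (volume.prod volume) :=
      (hu.comp_quasiMeasurePreserving (quasiMeasurePreserving_add volume volume)).aemeasurable
    have h2 : AEMeasurable (fun p : EuclideanSpace ℝ (Fin n) × EuclideanSpace ℝ (Fin n) =>
        u p.1) (volume.prod volume) :=
      (hu.comp_quasiMeasurePreserving Measure.quasiMeasurePreserving_fst).aemeasurable
    have h3 : Measurable fun p : EuclideanSpace ℝ (Fin n) × EuclideanSpace ℝ (Fin n) =>
        ‖p.2‖ ^ s := by fun_prop
    have h4 : Measurable fun p : EuclideanSpace ℝ (Fin n) × EuclideanSpace ℝ (Fin n) =>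
        ‖p.2‖ ^ n := by fun_prop
    exact ((hA.measurable_comp_abs.comp_aemeasurable ((h1.sub h2).div h3.aemeasurable)).div
      h4.aemeasurable).ennreal_ofReal
  rw [← lintegral_lintegral_swap hm, gagliardoModular]
  refine lintegral_congr fun y => ?_
  rw [← lintegral_add_right_eq_self _ y]
  simp only [add_sub_cancel_right, add_comm y]

/-! ### From modulars to Luxemburg norms. -/

theorem besselPotential_div {n : ℕ} (σ : ℝ) (f : EuclideanSpace ℝ (Fin n) → ℝ) (t : ℝ)
    (x : EuclideanSpace ℝ (Fin n)) :
    besselPotential σ (fun y => f y / t) x = besselPotential σ f x / t := by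
  simp only [besselPotential, convolution_def, ContinuousLinearMap.mul_apply', ← integral_div,
    mul_div_assoc]

theorem div_mem_orliczSpace {A : ℝ → ℝ} {n : ℕ} {f : EuclideanSpace ℝ (Fin n) → ℝ}
    (hf : f ∈ orliczSpace n A) {t : ℝ} (ht : 0 < t) : (fun y => f y / t) ∈ orliczSpace n A := by
  obtain ⟨hm, r, hr, h⟩ := hf
  refine ⟨(hm.aemeasurable.div_const t).aestronglyMeasurable, r / t, by positivity, ?_⟩
  have e : ∀ x, f x / t / (r / t) = f x / r := fun x => by field_simp
  simpa only [e] using h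

theorem IsYoungFunction.exists_orliczModular_le_one {A : ℝ → ℝ} (hA : IsYoungFunction A) {n : ℕ}
    {f : EuclideanSpace ℝ (Fin n) → ℝ} (hf : f ∈ orliczSpace n A) :
    ∃ t : ℝ, 0 < t ∧ orliczModular A (fun x => f x / t) ≤ 1 := by
  obtain ⟨hm, r, hr, h⟩ := hf
  set m : ℝ := (orliczModular A fun x => f x / r).toReal with hmd
  have hm0 : 0 ≤ m := ENNReal.toReal_nonneg
  -- Dividing further by `m + 1` scales the modular down to at most `m/(m + 1)`, by convexity.
  refine ⟨r * (m + 1), by positivity, ?_⟩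
  calc _ ≤ ENNReal.ofReal (m + 1)⁻¹ * orliczModular A fun x => f x / r := by
        rw [orliczModular, orliczModular, ← lintegral_const_mul' _ _ ENNReal.ofReal_ne_top]
        refine lintegral_mono fun x => ?_
        rw [← ENNReal.ofReal_mul (by positivity)]
        apply ENNReal.ofReal_le_ofReal
        have e : |f x / (r * (m + 1))| = (m + 1)⁻¹ * |f x / r| := by
          rw [← div_div, abs_div, abs_of_pos (by positivity : 0 < m + 1), div_eq_inv_mul]
        rw [e]
        exact hA.apply_mul_le (by positivity) (inv_le_one_of_one_le₀ (by linarith))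
          (abs_nonneg _)
    _ = ENNReal.ofReal ((m + 1)⁻¹ * m) := by
        rw [ENNReal.ofReal_mul (by positivity), hmd, ENNReal.ofReal_toReal h.ne]
    _ ≤ 1 := by
        rw [ENNReal.ofReal_le_one, inv_mul_le_iff₀ (by positivity)]; linarith

theorem luxemburgNorm_nonneg {A : ℝ → ℝ} {n : ℕ} (f : EuclideanSpace ℝ (Fin n) → ℝ) :
    0 ≤ luxemburgNorm A f := Real.sInf_nonneg fun _ h => h.1.le

theorem orliczModular_div_besselPotential_le {A : ℝ → ℝ} (hA : IsYoungFunction A) {n : ℕ}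
    {σ : ℝ} (hσ : 0 < σ) {f u : EuclideanSpace ℝ (Fin n) → ℝ} (hf : f ∈ orliczSpace n A)
    (hu : u =ᵐ[volume] besselPotential σ f) {t : ℝ} (ht : 0 < t) :
    orliczModular A (fun x => u x / t) ≤ orliczModular A (fun x => f x / t) := by
  have hu' : (fun x => u x / t) =ᵐ[volume] besselPotential σ fun x => f x / t := by
    filter_upwards [hu] with x hx
    rw [besselPotential_div, hx]
  have h := lintegral_apply_besselPotential_le hA hσ (div_mem_orliczSpace hf ht) hu'
  simpa only [orliczModular, integral_abs_besselKernel hσ, one_mul] using h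

/-- The factor relating the Gagliardo seminorm of a Bessel potential to the norm of its density. -/
noncomputable def gagliardoFactor (n : ℕ) (s σ : ℝ) : ℝ :=
  (2 + besselHolderConst n) *
    max 1 (2 * n * volume.real (Metric.ball (0 : EuclideanSpace ℝ (Fin n)) 1)) /
      (s * (1 - σ)) / (σ - s)

theorem gagliardoFactor_pos (n : ℕ) {s σ : ℝ} (hs : 0 < s) (hsσ : s < σ) (hσ1 : σ < 1) :
    0 < gagliardoFactor n s σ := by
  have h1 := besselHolderConst_pos n
  have h2 : 0 < 1 - σ := by linarith
  have h3 : 0 < σ - s := by linarith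
  unfold gagliardoFactor
  positivity

theorem one_div_add_one_div_le {s σ : ℝ} (hs : 0 < s) (hsσ : s < σ) (hσ1 : σ < 1) :
    1 / (σ - s) + 1 / s ≤ 2 / (s * (σ - s)) := by
  have h3 : 0 < σ - s := by linarith
  rw [div_add_div _ _ h3.ne' hs.ne', mul_comm (σ - s) s]
  gcongr
  linarith

theorem gagliardoModular_div_besselPotential_le {A : ℝ → ℝ} (hA : IsYoungFunction A) {n : ℕ}
    (hn : 1 ≤ n) {s σ : ℝ} (hs : 0 < s) (hsσ : s < σ) (hσ1 : σ < 1)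
    {f u : EuclideanSpace ℝ (Fin n) → ℝ} (hum : AEStronglyMeasurable u)
    (hf : f ∈ orliczSpace n A) (hu : u =ᵐ[volume] besselPotential σ f) {t : ℝ} (ht : 0 < t) :
    gagliardoModular A s (fun x => u x / (gagliardoFactor n s σ * t))
      ≤ orliczModular A (fun x => f x / t) := by
  have hσ : 0 < σ := hs.trans hsσ
  have hG := gagliardoFactor_pos n hs hsσ hσ1
  have hc := besselHolderConst_pos n
  have h2 : 0 < 1 - σ := by linarith
  have h3 : 0 < σ - s := by linarith
  set W : ℝ := n * volume.real (Metric.ball (0 : EuclideanSpace ℝ (Fin n)) 1)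
    * (1 / (σ - s) + 1 / s) with hW
  have hW0 : 0 ≤ W := by positivity
  -- `B` dominates both `1` and `W`, so `W · A(t/B) ≤ A(t)`. Accordingly `gagliardoFactor` is `B`
  -- times a bound for the dilation constant `2 + M`.
  set B : ℝ := max 1 (2 * n * volume.real (Metric.ball (0 : EuclideanSpace ℝ (Fin n)) 1)) /
    (s * (σ - s)) with hB
  have hss : s * (σ - s) ≤ 1 := by nlinarith
  have hB1 : 1 ≤ B := by
    rw [hB, le_div_iff₀ (by positivity), one_mul]
    exact hss.trans (le_max_left _ _)
  have hWB : W ≤ B := by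
    calc W ≤ n * volume.real (Metric.ball (0 : EuclideanSpace ℝ (Fin n)) 1)
          * (2 / (s * (σ - s))) := by
          rw [hW]; gcongr; exact one_div_add_one_div_le hs hsσ hσ1
      _ = 2 * n * volume.real (Metric.ball (0 : EuclideanSpace ℝ (Fin n)) 1)
          / (s * (σ - s)) := by ring
      _ ≤ B := by rw [hB]; gcongr; exact le_max_right _ _
  have hC : 2 * 1 + besselHolderConst n / (1 - σ) ≤ gagliardoFactor n s σ * B⁻¹ := by
    have e : gagliardoFactor n s σ * B⁻¹ = (2 + besselHolderConst n) / (1 - σ) := by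
      rw [gagliardoFactor, hB]
      field_simp
    rw [e, add_div]
    gcongr
    rw [le_div_iff₀ h2]
    linarith
  set T : ℝ := gagliardoFactor n s σ * t with hT
  have hT0 : 0 < T := by positivity
  have hu' : (fun x => u x / T) =ᵐ[volume] besselPotential σ fun x => f x / T := by
    filter_upwards [hu] with x hx
    rw [besselPotential_div, hx]
  rw [gagliardoModular_eq hA s (hum.aemeasurable.div_const T).aestronglyMeasurable]
  refine (lintegral_lintegral_difference_besselPotential_le hA hn hs hsσ hσ1
    (div_mem_orliczSpace hf hT0) hu').trans ?_
  rw [integral_abs_besselKernel hσ, orliczModular, ← hW,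
    ← lintegral_const_mul' _ _ ENNReal.ofReal_ne_top]
  refine lintegral_mono fun x => ?_
  rw [← ENNReal.ofReal_mul hW0]
  apply ENNReal.ofReal_le_ofReal
  have hle : (2 * 1 + besselHolderConst n / (1 - σ)) * |f x / T| ≤ B⁻¹ * |f x / t| := by
    calc _ ≤ gagliardoFactor n s σ * B⁻¹ * |f x / T| := by gcongr
      _ = _ := by
        rw [abs_div, abs_div, abs_of_pos ht, abs_of_pos hT0, hT]
        field_simp
  calc _ ≤ W * A (B⁻¹ * |f x / t|) := by
        gcongr
        exact hA.apply_le_apply (by positivity) hle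
    _ ≤ B * (B⁻¹ * A |f x / t|) := by
        have := hA.nonneg (abs_nonneg (f x / t))
        refine mul_le_mul hWB ?_ (hA.nonneg (by positivity)) (by positivity)
        exact hA.apply_mul_le (by positivity) (inv_le_one_of_one_le₀ hB1) (abs_nonneg _)
    _ = _ := by field_simp

theorem besselPotential_mem_fracOrliczSobolevSpace {A : ℝ → ℝ} (hA : IsYoungFunction A) {n : ℕ}
    (hn : 1 ≤ n) {s σ : ℝ} (hs : 0 < s) (hsσ : s < σ) (hσ1 : σ < 1)
    {f u : EuclideanSpace ℝ (Fin n) → ℝ} (hum : AEStronglyMeasurable u)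
    (hf : f ∈ orliczSpace n A) (hu : u =ᵐ[volume] besselPotential σ f) :
    u ∈ fracOrliczSobolevSpace n A s := by
  have hσ : 0 < σ := hs.trans hsσ
  obtain ⟨t, ht, h⟩ := hA.exists_orliczModular_le_one hf
  have hm : 0 < max 1 (gagliardoFactor n s σ) := by positivity
  -- One dilation must serve both modulars, hence the maximum of the two admissible factors.
  refine ⟨hum, max 1 (gagliardoFactor n s σ) * t, by positivity, ?_⟩
  have h1 := orliczModular_div_besselPotential_le hA hσ hf hu ht
  have h2 := gagliardoModular_div_besselPotential_le hA hn hs hsσ hσ1 hum hf hu ht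
  have hG := gagliardoFactor_pos n hs hsσ hσ1
  refine lt_of_le_of_lt (add_le_add (le_trans ?_ (h1.trans h)) (le_trans ?_ (h2.trans h)))
    (by norm_num)
  · refine lintegral_mono fun x => ENNReal.ofReal_le_ofReal ?_
    refine hA.apply_le_apply (abs_nonneg _) ?_
    rw [abs_div, abs_div, abs_of_pos ht,
      abs_of_pos (by positivity : 0 < max 1 (gagliardoFactor n s σ) * t)]
    gcongr
    exact le_mul_of_one_le_left ht.le (le_max_left _ _)
  · refine lintegral_mono fun y => lintegral_mono fun x => ENNReal.ofReal_le_ofReal ?_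
    gcongr
    refine hA.apply_le_apply (by positivity) ?_
    rw [← sub_div, ← sub_div, abs_div, abs_div, abs_of_pos (by positivity : 0 < max 1 (gagliardoFactor n s σ) * t),
      abs_of_pos (by positivity : 0 < gagliardoFactor n s σ * t)]
    gcongr
    exact le_max_right _ _

theorem fracOrliczSobolevNorm_besselPotential_le {A : ℝ → ℝ} (hA : IsYoungFunction A) {n : ℕ}
    (hn : 1 ≤ n) {s σ : ℝ} (hs : 0 < s) (hsσ : s < σ) (hσ1 : σ < 1)
    {f u : EuclideanSpace ℝ (Fin n) → ℝ} (hum : AEStronglyMeasurable u)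
    (hf : f ∈ orliczSpace n A) (hu : u =ᵐ[volume] besselPotential σ f) :
    fracOrliczSobolevNorm A s u ≤ (1 + gagliardoFactor n s σ) * luxemburgNorm A f := by
  have hσ : 0 < σ := hs.trans hsσ
  have hG := gagliardoFactor_pos n hs hsσ hσ1
  obtain ⟨t, ht, h⟩ := hA.exists_orliczModular_le_one hf
  rw [← div_le_iff₀' (by positivity)]
  -- Each `r` admissible for `f` is admissible for `u` in `L^A`, and `gagliardoFactor n s σ * r` is
  -- admissible for the seminorm. Nonemptiness matters because the infimum of the empty set is `0`.
  refine le_csInf ⟨t, ht, h⟩ fun r hr => ?_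
  rw [div_le_iff₀' (by positivity), add_mul, one_mul]
  refine add_le_add (csInf_le ⟨0, fun _ h => h.1.le⟩ ⟨hr.1, ?_⟩)
    (csInf_le ⟨0, fun _ h => h.1.le⟩ ⟨mul_pos hG hr.1, ?_⟩)
  · exact (orliczModular_div_besselPotential_le hA hσ hf hu hr.1).trans hr.2
  · exact (gagliardoModular_div_besselPotential_le hA hn hs hsσ hσ1 hum hf hu hr.1).trans hr.2

theorem one_add_gagliardoFactor_le (n : ℕ) {s σ : ℝ} (hs : 0 < s) (hsσ : s < σ) (hσ1 : σ < 1) :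
    1 + gagliardoFactor n s σ ≤ (1 + (2 + besselHolderConst n) *
      max 1 (2 * n * volume.real (Metric.ball (0 : EuclideanSpace ℝ (Fin n)) 1))) /
        (s * (1 - σ)) / (σ - s) := by
  have h2 : 0 < 1 - σ := by linarith
  have h3 : 0 < σ - s := by linarith
  rw [gagliardoFactor, add_div, add_div]
  gcongr
  rw [div_div, le_div_iff₀ (by positivity), one_mul]
  have : s * (1 - σ) ≤ 1 := by nlinarith
  calc s * (1 - σ) * (σ - s) ≤ 1 * 1 := by gcongr; linarith
    _ = 1 := one_mul 1

/-! ### The main theorem. -/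

theorem mainTheorem3 (n : ℕ) (hn : 1 ≤ n) :
    ∃ K c : ℝ, 0 < K ∧ 0 < c ∧
      ∀ (A : ℝ → ℝ) (s s' : ℝ), IsYoungFunction A → 0 < s → s < s' → s' < 1 →
        (∀ u ∈ besselOrliczSpace n A s',
          u ∈ fracOrliczSobolevSpace n A s ∧
          fracOrliczSobolevNorm A s u ≤
            (K / (s * (1 - s'))) / (s' - s) * besselOrliczNorm A s' u) ∧
        (∀ (f u : EuclideanSpace ℝ (Fin n) → ℝ), f ∈ orliczSpace n A →
          u =ᵐ[volume] besselPotential s' f →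
          ∀ N C₁ C₂ : ℝ,
            N = ∫ x, |besselKernel n s' x| →
            C₁ = 2 * n * volume.real (Metric.ball (0 : EuclideanSpace ℝ (Fin n)) 1) / s →
            C₂ = 2 * N + c / (1 - s') →
            (∫⁻ x, ENNReal.ofReal (A |u x|)) +
                ∫⁻ h, ∫⁻ x, ENNReal.ofReal (A (|u (x + h) - u x| / ‖h‖ ^ s) / ‖h‖ ^ n) ≤
              ENNReal.ofReal (C₁ / (s' - s)) * (∫⁻ x, ENNReal.ofReal (A (C₂ * |f x|))) +
                ∫⁻ x, ENNReal.ofReal (A (N * |f x|))) := by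
  have hc := besselHolderConst_pos n
  refine ⟨1 + (2 + besselHolderConst n) *
    max 1 (2 * n * volume.real (Metric.ball (0 : EuclideanSpace ℝ (Fin n)) 1)),
    besselHolderConst n, by positivity, hc, fun A s s' hA hs hss' hs'1 => ⟨?_, ?_⟩⟩
  · rintro u ⟨⟨hum, -⟩, f, hf, hu⟩
    refine ⟨besselPotential_mem_fracOrliczSobolevSpace hA hn hs hss' hs'1 hum hf hu, ?_⟩
    have hle := one_add_gagliardoFactor_le n hs hss' hs'1
    have hpos := (by linarith [gagliardoFactor_pos n hs hss' hs'1] :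
      0 < 1 + gagliardoFactor n s s').trans_le hle
    rw [← div_le_iff₀' hpos]
    -- The bound holds for every density representing `u`, so uniqueness of the density plays no
    -- role.
    refine le_csInf ⟨_, f, hf, hu, rfl⟩ ?_
    rintro r ⟨g, hg, hug, rfl⟩
    rw [div_le_iff₀' hpos]
    exact (fracOrliczSobolevNorm_besselPotential_le hA hn hs hss' hs'1 hum hg hug).trans
      (mul_le_mul_of_nonneg_right hle (luxemburgNorm_nonneg g))
  · rintro f u hf hu N C₁ C₂ rfl rfl rfl
    rw [add_comm]
    refine add_le_add
      ((lintegral_lintegral_difference_besselPotential_le hA hn hs hss' hs'1 hf hu).trans ?_)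
      (lintegral_apply_besselPotential_le hA (hs.trans hss') hf hu)
    gcongr ENNReal.ofReal ?_ * _
    calc _ ≤ n * volume.real (Metric.ball (0 : EuclideanSpace ℝ (Fin n)) 1)
          * (2 / (s * (s' - s))) := by
          gcongr; exact one_div_add_one_div_le hs hss' hs'1
      _ = _ := by rw [div_div]; ring
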